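/- \textbf{Setting.} Let $n\ge 1$ and let $\widetilde M$ be a compact (Hausdorff) smooth manifold of dimension $n+1$ with a projective structure $[\nabla]$, i.e. a class of smooth torsion-free affine connections modulo $\hat\nabla_a\xi^b=\nabla_a\xi^b+\Upsilon_a\xi^b+\Upsilon_c\xi^c\delta_a^b$ for smooth 1-forms $\Upsilon_a$. Let $\mathcal E(w)$ be the line bundle associated with the frame bundle and the representation $A\mapsto|\det A|^{w/(n+2)}$ of $GL_{n+1}(\mathbb R)$ (so that $\hat\nabla\tau=\nabla\tau+w\Upsilon\tau$ for sections $\tau$ of $\mathcal E(w)$), and write $\mathcal B(w)=\mathcal B\otimes\mathcal E(w)$. Let $\mathcal T$ be the standard projective tractor bundle, of rank $n+2$: every $\nabla\in[\nabla]$ identifies $\mathcal T\cong T\widetilde M(-1)\oplus\mathcal E(-1)$, $T^A\leftrightarrow(\xi^a,\rho)$, with $(\hat\xi^a,\hat\rho)=(\xi^a,\rho-\Upsilon_b\xi^b)$ under $\hat\nabla=\nabla+\Upsilon$. Let $X^A\in\Gamma(\mathcal T(1))$ be the canonical inclusion $\mathcal E(-1)\to\mathcal T$, $\rho\mapsto(0,\rho)$.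 The normal tractor connection is $\nabla_a(\xi^b,\rho)=(\nabla_a\xi^b+\delta_a^b\rho,\ \nabla_a\rho-P_{ab}\xi^b)$, where, with the conventions $(\nabla_a\nabla_b-\nabla_b\nabla_a)\xi^c=R_{ab}{}^c{}_d\xi^d$ and $R_{ab}=R_{da}{}^d{}_b$, the Schouten tensor is given by $nP_{ab}=R_{ab}+\beta_{ab}$ with $\beta_{ab}=-\frac{1}{n+2}(R_{ab}-R_{ba})$. Let $H^{AB}$ be a smooth symmetric section of $\mathcal T\otimes\mathcal T$, non-degenerate of signature $(2,n)$ (two minus and $n$ plus signs), with $\nabla_aH^{AB}=0$, and let $\Phi_{AB}$ be its pointwise inverse. Let $I^A$ be a smooth nowhere vanishing section of $\mathcal T$ with $\nabla_aI^A=0$ and $\Phi_{AB}I^AI^B=0$. Put $\sigma=\Phi_{AB}I^AX^B\in\Gamma(\mathcal E(1))$ and $\lambda=\Phi_{AB}X^AX^B\in\Gamma(\mathcal E(2))$, let $n^a\in\Gamma(T\widetilde M(-1))$ be the image of $I^A$, and let $N^a=\sigma n^a$, a vector field. Let $\mathcal O=\{\sigma\ne0\}$ and $l=\sigma^{-2}\lambda:\mathcal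 O\to\mathbb R$. \textbf{Theorem.} The set $\mathcal O$ is open, and $N$ has a globally defined flow $\phi:\mathbb R\times\mathcal O\to\mathcal O$. Let $\mathcal Q_{\mathcal O}=\mathcal O/\mathbb R$ be the quotient of $\mathcal O$ by this flow, with the quotient topology, and $\pi:\mathcal O\to\mathcal Q_{\mathcal O}$ the projection, whose fibres are the orbits of $\phi$. Then: \begin{enumerate} \item $\mathcal Q_{\mathcal O}$ is Hausdorff and second countable, and there is a unique smooth ($n$-dimensional) structure on $\mathcal Q_{\mathcal O}$ for which $\pi$ carries the structure of a principal $\mathbb R$-bundle; for it, the action $\phi$ makes $\pi$ a principal $\mathbb R$-bundle. \item The zero set of $l$ is the image of a smooth global section of $\pi$, and the map $\mathcal O\to\mathbb R\times\mathcal Q_{\mathcal O}$, $x\mapsto(\tfrac12l(x),\pi(x))$, is a diffeomorphism, equivariant in the sense that $\phi_t(x)\mapsto(\tfrac12l(x)+t,\pi(x))$. \item The 1-form $\omega_a=\tfrac12\nabla_al$, i.e. $\omega=\tfrac12\,dl$, on $\mathcal O$ is a principal connection for this bundle: it is smooth, takes the value $1$ on the fundamental vector field of $1\in\mathbb R$,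 and is invariant under $\phi$. \end{enumerate} -/

import Mathlib

open Set Bundle Module
open scoped Manifold ContDiff

noncomputable section

namespace ProjTractor

/-- The model space `ℝ^d`. -/
abbrev Model (d : ℕ) : Type := EuclideanSpace ℝ (Fin d)

/-! ## Projective structures -/

section Projective

variable {n : ℕ} {M : Type*} [TopologicalSpace M] [ChartedSpace (Model (n + 1)) M]

/-- Affine connections on the tangent bundle of the `(n+1)`-dimensional manifold `M`. -/
abbrev AffineConnection (n : ℕ) (M : Type*) [TopologicalSpace M]
    [ChartedSpace (Model (n + 1)) M] [IsManifold 𝓘(ℝ, Model (n + 1)) ∞ M] : Type _ :=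
  CovariantDerivative 𝓘(ℝ, Model (n + 1)) (Model (n + 1))
    (TangentSpace 𝓘(ℝ, Model (n + 1)) : M → Type _)

/-- A smooth `1`-form: a smooth section of `T*M`. -/
def SmoothOneForm {d : ℕ} {P : Type*} [TopologicalSpace P] [ChartedSpace (Model d) P]
    [IsManifold 𝓘(ℝ, Model d) ∞ P]
    (θ : ∀ x : P, TangentSpace 𝓘(ℝ, Model d) x →L[ℝ] ℝ) : Prop :=
  ContMDiff 𝓘(ℝ, Model d) (𝓘(ℝ, Model d).prod 𝓘(ℝ, Model d →L[ℝ] ℝ)) ∞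
    (fun x ↦ (⟨x, θ x⟩ : TotalSpace (Model d →L[ℝ] ℝ)
      (fun x : P ↦ TangentSpace 𝓘(ℝ, Model d) x →L[ℝ] Bundle.Trivial P ℝ x)))

variable [IsManifold 𝓘(ℝ, Model (n + 1)) ∞ M]

/-- At the point `x`, `∇' = ∇ + Υ`, that is
`∇'_v ξ = ∇_v ξ + Υ(v) ξ + Υ(ξ) v` for all `v ∈ T_x M` and all vector fields `ξ`. -/
def IsProjectiveChangeAt (cov cov' : AffineConnection n M) (x : M)
    (Υ : TangentSpace 𝓘(ℝ, Model (n + 1)) x →L[ℝ] ℝ) : Prop :=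
  ∀ ξ : (∀ y : M, TangentSpace 𝓘(ℝ, Model (n + 1)) y),
    MDifferentiableAt 𝓘(ℝ, Model (n + 1)) (𝓘(ℝ, Model (n + 1)).prod 𝓘(ℝ, Model (n + 1)))
      (fun y ↦ (⟨y, ξ y⟩ : TangentBundle 𝓘(ℝ, Model (n + 1)) M)) x →
    ∀ v : TangentSpace 𝓘(ℝ, Model (n + 1)) x,
      cov' ξ x v = cov ξ x v + Υ v • ξ x + Υ (ξ x) • v

/-- Projective equivalence of connections: `∇' = ∇ + Υ` for some smooth `1`-form `Υ`. -/
def ProjectivelyEquivalent (cov cov' : AffineConnection n M) : Prop :=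
  ∃ Υ : ∀ x : M, TangentSpace 𝓘(ℝ, Model (n + 1)) x →L[ℝ] ℝ,
    SmoothOneForm Υ ∧ ∀ x, IsProjectiveChangeAt cov cov' x (Υ x)

variable (n M) in
/-- A projective structure: a projective equivalence class of smooth torsion-free affine
connections. -/
structure ProjectiveStructure where
  /-- the connections in the class -/
  conns : Set (AffineConnection n M)
  nonempty : conns.Nonempty
  smooth : ∀ cov ∈ conns, CovariantDerivative.ContMDiffCovariantDerivative cov ∞
  torsion_free : ∀ cov ∈ conns, cov.torsion = 0
  mem_iff : ∀ cov ∈ conns, ∀ cov' : AffineConnection n M,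
    CovariantDerivative.ContMDiffCovariantDerivative cov' ∞ → cov'.torsion = 0 →
      (cov' ∈ conns ↔ ProjectivelyEquivalent cov cov')

/-! ## Frames and densities -/

/-- The fibre at `x` of the frame bundle. The group `GL_{n+1}` acts on the right by
`e · A = e ∘ A`, which is written `A.trans e`. -/
abbrev Frame (x : M) : Type _ :=
  Model (n + 1) ≃L[ℝ] TangentSpace 𝓘(ℝ, Model (n + 1)) x

/-- `|det A|`. -/
def absDet (A : Model (n + 1) ≃L[ℝ] Model (n + 1)) : ℝ :=
  |LinearMap.det (A : Model (n + 1) →ₗ[ℝ] Model (n + 1))|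

open Classical in
/-- The coordinate frame `∂/∂x^i` at `y` of the preferred chart at `x₀` (for `y` in the domain of
that chart; an irrelevant value elsewhere). -/
def coordFrame (x₀ y : M) : Frame (n := n) y :=
  if h : y ∈ (trivializationAt (Model (n + 1)) (TangentSpace 𝓘(ℝ, Model (n + 1))) x₀).baseSet then
    ((trivializationAt (Model (n + 1))
      (TangentSpace 𝓘(ℝ, Model (n + 1))) x₀).continuousLinearEquivAt ℝ y h).symm
  else ContinuousLinearEquiv.refl ℝ (Model (n + 1))

variable (n) in
/-- The fibre at `x` of the bundle `E(w)` of projective densities of weight `w`, associated with the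
frame bundle and the representation `A ↦ |det A|^{w/(n+2)}`: the functions `f` of a frame
with `f (e · A) = |det A|^{-w/(n+2)} f(e)`. -/
def Density (w : ℝ) (x : M) : Submodule ℝ (Frame (n := n) x → ℝ) where
  carrier := {f | ∀ (e : Frame x) (A : Model (n + 1) ≃L[ℝ] Model (n + 1)),
    f (A.trans e) = absDet A ^ (-w / (n + 2 : ℝ)) * f e}
  add_mem' := by
    intro f g hf hg e A
    simp [hf e A, hg e A, mul_add]
  zero_mem' := by
    intro e A
    simp
  smul_mem' := by
    intro c f hf e A
    simp [hf e A]
    ring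

theorem absDet_pos (A : Model (n + 1) ≃L[ℝ] Model (n + 1)) : 0 < absDet A := by
  have h := LinearEquiv.isUnit_det' A.toLinearEquiv
  exact abs_pos.mpr h.ne_zero

theorem absDet_trans (A B : Model (n + 1) ≃L[ℝ] Model (n + 1)) :
    absDet (A.trans B) = absDet A * absDet B := by
  have h : ((A.trans B : Model (n + 1) ≃L[ℝ] Model (n + 1)) :
      Model (n + 1) →ₗ[ℝ] Model (n + 1)) =
      (B : Model (n + 1) →ₗ[ℝ] Model (n + 1)) ∘ₗ (A : Model (n + 1) →ₗ[ℝ] Model (n + 1)) := rfl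
  rw [absDet, h, LinearMap.det_comp, abs_mul, mul_comm]
  rfl

/-! ## Standard tractors -/

/-- The fibre at `x` of the standard tractor bundle `T`. A scale `∇` in the projective class splits
`T` as `TM(-1) ⊕ E(-1)`, and a frame `e` turns the splitting into components
`T ∇ e = (a, r) ∈ ℝ^{n+1} × ℝ`, standing for `ξ^a W_a + ρ X` with `ξ = e(a)` and `ρ = r` relative to
the frame. The first condition is the change of frame for fields of weight `-1`, the second one is
the change of scale `ξ ↦ ξ`, `ρ ↦ ρ - Υ(ξ)` under `∇ ↦ ∇ + Υ`. -/
def ProjectiveStructure.Tractor (c : ProjectiveStructure n M) (x : M) :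
    Submodule ℝ (c.conns → Frame (n := n) x → Model (n + 1) × ℝ) where
  carrier := {T |
    (∀ (cov : c.conns) (e : Frame x) (A : Model (n + 1) ≃L[ℝ] Model (n + 1)),
      T cov (A.trans e) =
        absDet A ^ (1 / (n + 2 : ℝ)) • (A.symm (T cov e).1, (T cov e).2)) ∧
    (∀ (cov cov' : c.conns) (e : Frame x) (Υ : TangentSpace 𝓘(ℝ, Model (n + 1)) x →L[ℝ] ℝ),
      IsProjectiveChangeAt cov.1 cov'.1 x Υ →
        T cov' e = ((T cov e).1, (T cov e).2 - Υ (e (T cov e).1)))}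
  add_mem' := by
    rintro S T ⟨hS, hS'⟩ ⟨hT, hT'⟩
    refine ⟨fun cov e A ↦ ?_, fun cov cov' e Υ h ↦ ?_⟩
    · simp only [Pi.add_apply, hS cov e A, hT cov e A]
      ext <;> simp <;> ring
    · simp only [Pi.add_apply, hS' cov cov' e Υ h, hT' cov cov' e Υ h]
      refine Prod.ext (by simp) ?_
      simp only [Prod.snd_add, Prod.fst_add, map_add]
      ring
  zero_mem' := by
    refine ⟨fun cov e A ↦ ?_, fun cov cov' e Υ h ↦ ?_⟩
    · ext <;> simp
    · ext <;> simp
  smul_mem' := by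
    rintro k S ⟨hS, hS'⟩
    refine ⟨fun cov e A ↦ ?_, fun cov cov' e Υ h ↦ ?_⟩
    · simp only [Pi.smul_apply, hS cov e A]
      ext <;> simp <;> ring
    · simp only [Pi.smul_apply, hS' cov cov' e Υ h]
      refine Prod.ext (by simp) ?_
      simp only [Prod.smul_snd, Prod.smul_fst, map_smul, smul_eq_mul]
      ring

variable {c : ProjectiveStructure n M}

/-- Components of a tractor in a scale and a frame, as a linear map. -/
def tractorComp (cov : c.conns) {x : M} (e : Frame (n := n) x) :
    c.Tractor x →ₗ[ℝ] Model (n + 1) × ℝ where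
  toFun T := T.1 cov e
  map_add' _ _ := rfl
  map_smul' _ _ := rfl

/-- The canonical tractor `X ∈ T(1)`, i.e. the inclusion `X : E(-1) → T`, `ρ ↦ ρ X`, evaluated on
the element of `E(-1)` whose value in the frame `e` is `1`. -/
def canonicalTractor (c : ProjectiveStructure n M) {x : M} (e : Frame (n := n) x) :
    c.Tractor x :=
  ⟨fun _ e' ↦ (0, absDet (e'.trans e.symm) ^ (1 / (n + 2 : ℝ))), by
    refine ⟨fun cov e' A ↦ ?_, fun cov cov' e' Υ h ↦ ?_⟩
    · have h : (A.trans e').trans e.symm = A.trans (e'.trans e.symm) := rfl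
      beta_reduce
      rw [h, absDet_trans, Real.mul_rpow (absDet_pos _).le (absDet_pos _).le]
      ext <;> simp
    · simp⟩

theorem canonicalTractor_trans {x : M} (e : Frame (n := n) x)
    (A : Model (n + 1) ≃L[ℝ] Model (n + 1)) :
    canonicalTractor c (A.trans e) = absDet A ^ (-1 / (n + 2 : ℝ)) • canonicalTractor c e := by
  refine Subtype.ext ?_
  funext cov e'
  have h : e'.trans e.symm = (e'.trans (A.trans e).symm).trans A := by
    exact ContinuousLinearEquiv.ext (funext fun v ↦ by simp)
  change ((0 : Model (n + 1)), absDet (e'.trans (A.trans e).symm) ^ (1 / (n + 2 : ℝ))) =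
    absDet A ^ (-1 / (n + 2 : ℝ)) •
      ((0 : Model (n + 1)), absDet (e'.trans e.symm) ^ (1 / (n + 2 : ℝ)))
  rw [Prod.smul_mk, smul_zero, smul_eq_mul, h, absDet_trans, Real.mul_rpow (absDet_pos _).le (absDet_pos _).le, mul_left_comm,
    ← Real.rpow_add (absDet_pos A), neg_div, neg_add_cancel, Real.rpow_zero, mul_one]

/-! ## The normal tractor connection -/

/-- The curvature `R(X,Y)Z = ∇_X ∇_Y Z - ∇_Y ∇_X Z - ∇_{[X,Y]} Z` at `x`. -/
def curvature (cov : AffineConnection n M)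
    (X Y Z : ∀ y : M, TangentSpace 𝓘(ℝ, Model (n + 1)) y) (x : M) :
    TangentSpace 𝓘(ℝ, Model (n + 1)) x :=
  cov (fun y ↦ cov Z y (Y y)) x (X x) - cov (fun y ↦ cov Z y (X y)) x (Y x)
    - cov Z x (VectorField.mlieBracket 𝓘(ℝ, Model (n + 1)) X Y x)

/-- The Ricci tensor `Ric(u,v) = tr (w ↦ R(w,u)v)`; the curvature tensor is evaluated on the local
extensions of tangent vectors with constant coefficients in the coordinate frame. -/
def ricci (cov : AffineConnection n M) (x : M)
    (u v : TangentSpace 𝓘(ℝ, Model (n + 1)) x) : ℝ :=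
  ∑ i : Fin (n + 1), (coordFrame x x).symm
    (curvature cov
      (FiberBundle.extend (Model (n + 1)) (coordFrame x x (EuclideanSpace.single i 1)))
      (FiberBundle.extend (Model (n + 1)) u) (FiberBundle.extend (Model (n + 1)) v) x) i

/-- The projective Schouten tensor: `n P_{ab} = R_{ab} + β_{ab}` with
`β_{ab} = -(2/(n+2)) R_{[ab]}` (and `M` of dimension `n + 1`). -/
def schouten (cov : AffineConnection n M) (x : M)
    (u v : TangentSpace 𝓘(ℝ, Model (n + 1)) x) : ℝ :=
  (ricci cov x u v - (ricci cov x u v - ricci cov x v u) / (n + 2)) / n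

/-- The connection form at `x` of an affine connection in the coordinate frame `e` around `x`,
applied to `v ∈ T_x M`: the matrix `Γ(v)` with `∇_v e_i = Γ(v)^j_i e_j`. -/
def connForm (cov : AffineConnection n M) (x : M)
    (v : TangentSpace 𝓘(ℝ, Model (n + 1)) x) : Model (n + 1) →ₗ[ℝ] Model (n + 1) :=
  (EuclideanSpace.basisFun (Fin (n + 1)) ℝ).toBasis.constr ℝ fun i ↦
    (coordFrame x x).symm
      (cov (FiberBundle.extend (Model (n + 1)) (coordFrame x x (EuclideanSpace.single i 1))) x v)

/-- The linear form `a ↦ P(v, e(a))`, for the coordinate frame `e` around `x`. -/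
def schoutenForm (cov : AffineConnection n M) (x : M)
    (v : TangentSpace 𝓘(ℝ, Model (n + 1)) x) : Model (n + 1) →ₗ[ℝ] ℝ :=
  (EuclideanSpace.basisFun (Fin (n + 1)) ℝ).toBasis.constr ℝ fun i ↦
    schouten cov x v (coordFrame x x (EuclideanSpace.single i 1))

/-- The connection form at `x` of the normal tractor connection, in the scale `∇` and the coordinate
frame `e` around `x`. As `∇X = W` and `∇_a W_b = -P_{ab} X`, the tractor connection is
`∇_v (ξ, ρ) = (∇_v ξ + ρ v, ∇_v ρ - P(v, ξ))`; the terms in `tr Γ(v)` are those of the connection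
on `E(-1)`. -/
def tractorConnForm (cov : AffineConnection n M) (x : M)
    (v : TangentSpace 𝓘(ℝ, Model (n + 1)) x) :
    Model (n + 1) × ℝ →ₗ[ℝ] Model (n + 1) × ℝ where
  toFun p :=
    (connForm cov x v p.1 - (LinearMap.trace ℝ _ (connForm cov x v) / (n + 2)) • p.1
        + p.2 • (coordFrame x x).symm v,
      - (LinearMap.trace ℝ _ (connForm cov x v) / (n + 2)) * p.2 - schoutenForm cov x v p.1)
  map_add' p q := by
    refine Prod.ext ?_ ?_
    · simp only [Prod.fst_add, Prod.snd_add, map_add]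
      module
    · simp only [Prod.fst_add, Prod.snd_add, map_add]
      ring
  map_smul' k p := by
    refine Prod.ext ?_ ?_
    · simp only [Prod.smul_fst, Prod.smul_snd, map_smul, RingHom.id_apply, smul_eq_mul]
      module
    · simp only [Prod.smul_fst, Prod.smul_snd, map_smul, RingHom.id_apply, smul_eq_mul]
      ring

/-- Components of a tractor field in the scale `∇` and the coordinate frame around `x₀`. -/
def fieldComp (T : ∀ x : M, c.Tractor x) (cov : c.conns) (x₀ y : M) : Model (n + 1) × ℝ :=
  tractorComp cov (coordFrame x₀ y) (T y)

/-- Components of a section `H^{AB}` of `T ⊗ T` (at each point, a bilinear form on the dual of the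
tractor space) in the scale `∇` and the coordinate frame around `x₀`, evaluated on the covectors
`α`, `β`. -/
def tensorComp (H : ∀ x : M, LinearMap.BilinForm ℝ (Dual ℝ (c.Tractor x))) (cov : c.conns)
    (x₀ : M) (α β : Dual ℝ (Model (n + 1) × ℝ)) (y : M) : ℝ :=
  H y (α ∘ₗ tractorComp cov (coordFrame x₀ y)) (β ∘ₗ tractorComp cov (coordFrame x₀ y))

/-- Smooth tractor fields. -/
def SmoothTractor (T : ∀ x : M, c.Tractor x) : Prop :=
  ∀ (cov : c.conns) (x₀ : M),
    ContMDiffOn 𝓘(ℝ, Model (n + 1)) 𝓘(ℝ, Model (n + 1) × ℝ) ∞ (fieldComp T cov x₀)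
      (chartAt (Model (n + 1)) x₀).source

/-- Smooth sections of `T ⊗ T`. -/
def SmoothTensor (H : ∀ x : M, LinearMap.BilinForm ℝ (Dual ℝ (c.Tractor x))) : Prop :=
  ∀ (cov : c.conns) (x₀ : M) (α β : Dual ℝ (Model (n + 1) × ℝ)),
    ContMDiffOn 𝓘(ℝ, Model (n + 1)) 𝓘(ℝ, ℝ) ∞ (tensorComp H cov x₀ α β)
      (chartAt (Model (n + 1)) x₀).source

/-- `∇_a T^A = 0`, for the tractor connection. -/
def ParallelTractor (T : ∀ x : M, c.Tractor x) : Prop :=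
  ∀ (cov : c.conns) (x : M) (v : TangentSpace 𝓘(ℝ, Model (n + 1)) x),
    mvfderiv 𝓘(ℝ, Model (n + 1)) (fieldComp T cov x) x v
      + tractorConnForm cov.1 x v (fieldComp T cov x x) = 0

/-- `∇_a H^{AB} = 0`, for the connection on `T ⊗ T` induced by the tractor connection. -/
def ParallelTensor (H : ∀ x : M, LinearMap.BilinForm ℝ (Dual ℝ (c.Tractor x))) : Prop :=
  ∀ (cov : c.conns) (x : M) (v : TangentSpace 𝓘(ℝ, Model (n + 1)) x)
    (α β : Dual ℝ (Model (n + 1) × ℝ)),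
    mvfderiv 𝓘(ℝ, Model (n + 1)) (tensorComp H cov x α β) x v
      + tensorComp H cov x (α ∘ₗ tractorConnForm cov.1 x v) β x
      + tensorComp H cov x α (β ∘ₗ tractorConnForm cov.1 x v) x = 0

/-! ## The holonomy reduction, and the quantities `σ`, `λ`, `n`, `N`, `l` -/

/-- A normal non-degenerate solution `H^{AB}` of the metrisability equation, of signature `(2,n)`
(two minus signs and `n` plus signs), with its pointwise inverse `Φ_{AB}`, and a nowhere vanishing
parallel null tractor `I^A`. -/
structure HolonomyReduction (c : ProjectiveStructure n M) where
  /-- the tractor metric `H^{AB}` -/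
  H : ∀ x : M, LinearMap.BilinForm ℝ (Dual ℝ (c.Tractor x))
  /-- the inverse `Φ_{AB}` of `H^{AB}` -/
  Φ : ∀ x : M, LinearMap.BilinForm ℝ (c.Tractor x)
  /-- the tractor `I^A` -/
  I : ∀ x : M, c.Tractor x
  H_symm : ∀ x α β, H x α β = H x β α
  H_signature : ∀ x, ∃ b : Basis (Fin 2 ⊕ Fin n) ℝ (Dual ℝ (c.Tractor x)),
    ∀ i j, H x (b i) (b j) = if i = j then Sum.elim (fun _ ↦ -1) (fun _ ↦ 1) i else 0
  H_smooth : SmoothTensor H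
  H_parallel : ParallelTensor H
  Φ_inverse : ∀ x (S : c.Tractor x) (β : Dual ℝ (c.Tractor x)), H x (Φ x S) β = β S
  I_ne_zero : ∀ x, I x ≠ 0
  I_null : ∀ x, Φ x (I x) (I x) = 0
  I_smooth : SmoothTractor I
  I_parallel : ParallelTractor I

namespace HolonomyReduction

variable (D : HolonomyReduction c)

/-- The density `σ = Φ_{AB} I^A X^B` of weight `1`. -/
def sigma (x : M) : Density n 1 x :=
  ⟨fun e ↦ D.Φ x (D.I x) (canonicalTractor c e), fun e A ↦ by
    simp [canonicalTractor_trans]⟩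

/-- The density `λ = Φ_{AB} X^A X^B` of weight `2`. -/
def lam (x : M) : Density n 2 x :=
  ⟨fun e ↦ D.Φ x (canonicalTractor c e) (canonicalTractor c e), fun e A ↦ by
    simp only [canonicalTractor_trans, map_smul, LinearMap.smul_apply, smul_eq_mul]
    rw [← mul_assoc, ← Real.rpow_add (absDet_pos A)]
    congr 2
    ring⟩

/-- The value in the frame `e` of `n^a`, the image of `I^A` in `TM(-1)`. (It is the same in all
scales.) -/
def nvec {x : M} (e : Frame (n := n) x) : TangentSpace 𝓘(ℝ, Model (n + 1)) x :=
  e (tractorComp ⟨c.nonempty.some, c.nonempty.some_mem⟩ e (D.I x)).1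

/-- The vector field `N = σ n` of weight `0` on `M`; it is computed in one frame at each point, and
is independent of this frame. -/
def N (x : M) : TangentSpace 𝓘(ℝ, Model (n + 1)) x :=
  (D.sigma x).1 (coordFrame x x) • D.nvec (coordFrame x x)

/-- The function `l = σ⁻² λ` of weight `0` on `{σ ≠ 0}`; it is computed in one frame at each point,
and is independent of this frame. -/
def l (x : M) : ℝ :=
  ((D.sigma x).1 (coordFrame x x))⁻¹ ^ 2 * (D.lam x).1 (coordFrame x x)

/-- The set `{σ ≠ 0}`. -/
def openOrbit : Set M := {x | D.sigma x ≠ 0}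

theorem exists_frame_change {x : M} (e e' : Frame (n := n) x) :
    ∃ A : Model (n + 1) ≃L[ℝ] Model (n + 1), e' = A.trans e :=
  ⟨e'.trans e.symm, ContinuousLinearEquiv.ext (funext fun v ↦ by simp)⟩

theorem N_eq {x : M} (e : Frame (n := n) x) : D.N x = (D.sigma x).1 e • D.nvec e := by
  obtain ⟨A, hA⟩ := exists_frame_change e (coordFrame x x)
  have h := (D.I x).2.1 ⟨c.nonempty.some, c.nonempty.some_mem⟩ e A
  have hs := (D.sigma x).2 e A
  have h' : D.nvec (A.trans e) = absDet A ^ (1 / (n + 2 : ℝ)) • D.nvec e := by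
    simp only [nvec, tractorComp, LinearMap.coe_mk, AddHom.coe_mk]
    rw [h]
    simp
  rw [N, hA, h', hs, smul_smul, mul_right_comm, ← Real.rpow_add (absDet_pos A), neg_div,
    neg_add_cancel, Real.rpow_zero, one_mul]

theorem l_eq {x : M} (e : Frame (n := n) x) :
    D.l x = ((D.sigma x).1 e)⁻¹ ^ 2 * (D.lam x).1 e := by
  obtain ⟨A, hA⟩ := exists_frame_change e (coordFrame x x)
  have hs := (D.sigma x).2 e A
  have hl := (D.lam x).2 e A
  have hp : (absDet A ^ (-1 / (n + 2 : ℝ))) ^ 2 = absDet A ^ (-2 / (n + 2 : ℝ)) := by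
    rw [← Real.rpow_natCast, ← Real.rpow_mul (absDet_pos A).le]
    congr 1
    push_cast
    ring
  have h0 : absDet A ^ (-2 / (n + 2 : ℝ)) ≠ 0 := (Real.rpow_pos_of_pos (absDet_pos A) _).ne'
  rw [l, hA, hs, hl, mul_inv, mul_pow, inv_pow (absDet A ^ (-1 / (n + 2 : ℝ))), hp]
  generalize absDet A ^ (-2 / (n + 2 : ℝ)) = k at h0
  field_simp

end HolonomyReduction

end Projective

/-! ## Orbit spaces, principal `ℝ`-bundles and connections -/

section Bundles

/-- Two points of `O` are related when an integral curve `ℝ → M` of the vector field `V` joins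
them. -/
def SameOrbit {d : ℕ} {M : Type*} [TopologicalSpace M] [ChartedSpace (Model d) M]
    (V : ∀ x : M, TangentSpace 𝓘(ℝ, Model d) x) (O : TopologicalSpace.Opens M) (x y : O) : Prop :=
  ∃ (γ : ℝ → M) (t : ℝ), IsMIntegralCurve (I := 𝓘(ℝ, Model d)) γ V ∧ γ 0 = x ∧ γ t = y

/-- The quotient of `O` by the flow of `V`, with the quotient topology. -/
def OrbitSpace {d : ℕ} {M : Type*} [TopologicalSpace M] [ChartedSpace (Model d) M]
    (V : ∀ x : M, TangentSpace 𝓘(ℝ, Model d) x) (O : TopologicalSpace.Opens M) : Type _ :=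
  Quot (SameOrbit V O)

instance {d : ℕ} {M : Type*} [TopologicalSpace M] [ChartedSpace (Model d) M]
    (V : ∀ x : M, TangentSpace 𝓘(ℝ, Model d) x) (O : TopologicalSpace.Opens M) :
    TopologicalSpace (OrbitSpace V O) :=
  inferInstanceAs (TopologicalSpace (Quot (SameOrbit V O)))

/-- The canonical projection. -/
def OrbitSpace.proj {d : ℕ} {M : Type*} [TopologicalSpace M] [ChartedSpace (Model d) M]
    (V : ∀ x : M, TangentSpace 𝓘(ℝ, Model d) x) (O : TopologicalSpace.Opens M) :
    O → OrbitSpace V O :=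
  Quot.mk (SameOrbit V O)

/-- `φ` is the flow of `V` on `O`: for all `x ∈ O`, the curve `t ↦ φ t x` is defined for all times,
stays in `O`, starts at `x`, and is an integral curve of `V`. -/
def IsGlobalFlow {d : ℕ} {M : Type*} [TopologicalSpace M] [ChartedSpace (Model d) M]
    (V : ∀ x : M, TangentSpace 𝓘(ℝ, Model d) x) (O : TopologicalSpace.Opens M)
    (φ : ℝ → O → O) : Prop :=
  ∀ x : O, φ 0 x = x ∧ IsMIntegralCurve (I := 𝓘(ℝ, Model d)) (fun t ↦ (φ t x : M)) V

variable {d m : ℕ} {P : Type*} [TopologicalSpace P] [ChartedSpace (Model d) P]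

/-- `φ : ℝ × P → P` is a smooth action of the Lie group `(ℝ, +)` on `P`, and makes `pr : P → B` a
principal `ℝ`-bundle: `pr` is smooth, and over a neighbourhood `U` of every point of `B` there is an
equivariant diffeomorphism `pr⁻¹(U) ≅ U × ℝ` over `U`. -/
structure IsPrincipalRealBundle {B : Type*} [TopologicalSpace B] [ChartedSpace (Model m) B]
    (φ : ℝ → P → P) (pr : P → B) : Prop where
  act_smooth : ContMDiff (𝓘(ℝ, ℝ).prod 𝓘(ℝ, Model d)) 𝓘(ℝ, Model d) ∞
    (fun q : ℝ × P ↦ φ q.1 q.2)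
  act_zero : ∀ p, φ 0 p = p
  act_add : ∀ s t p, φ (s + t) p = φ s (φ t p)
  proj_smooth : ContMDiff 𝓘(ℝ, Model d) 𝓘(ℝ, Model m) ∞ pr
  local_triv : ∀ b : B, ∃ (U : Set B) (Ψ : OpenPartialHomeomorph P (B × ℝ)),
    IsOpen U ∧ b ∈ U ∧ Ψ.source = pr ⁻¹' U ∧ Ψ.target = U ×ˢ univ ∧
    ContMDiffOn 𝓘(ℝ, Model d) (𝓘(ℝ, Model m).prod 𝓘(ℝ, ℝ)) ∞ Ψ Ψ.source ∧
    ContMDiffOn (𝓘(ℝ, Model m).prod 𝓘(ℝ, ℝ)) 𝓘(ℝ, Model d) ∞ Ψ.symm Ψ.target ∧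
    (∀ p ∈ Ψ.source, (Ψ p).1 = pr p) ∧
    ∀ p ∈ Ψ.source, ∀ t, Ψ (φ t p) = (pr p, (Ψ p).2 + t)

/-- A principal connection for the action `φ` of the abelian group `ℝ`, with values in its Lie
algebra `ℝ`: a smooth `1`-form that takes the value `1` on the fundamental vector field of
`1 ∈ ℝ` and is invariant under the action. -/
structure IsPrincipalConnection [IsManifold 𝓘(ℝ, Model d) ∞ P] (φ : ℝ → P → P)
    (θ : ∀ p : P, TangentSpace 𝓘(ℝ, Model d) p →L[ℝ] ℝ) : Prop where
  smooth : SmoothOneForm θ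
  fundamental : ∀ p : P,
    θ (φ 0 p) (mfderiv 𝓘(ℝ, ℝ) 𝓘(ℝ, Model d) (fun t : ℝ ↦ φ t p) 0 (1 : ℝ)) = 1
  invariant : ∀ (t : ℝ) (p : P) (v : TangentSpace 𝓘(ℝ, Model d) p),
    θ (φ t p) (mfderiv 𝓘(ℝ, Model d) 𝓘(ℝ, Model d) (φ t) p v) = θ p v

end Bundles

end ProjTractor

end

/-!
# The quotient of the open orbit by the flow of `N`

Why the theorem holds. Along an integral curve `γ` of `N = σ n`, the tractor `X` satisfies
`∇_N X = σ I - κ X` for a scalar function `κ` depending on the trivialisation of the densities,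
because `I` is `n` in the top slot. As `I` and `Φ` are parallel and `I` is null, this gives
`σ' = -κ σ` and `λ' = 2 (σ² - κ λ)`, so that `l = σ⁻² λ` satisfies `l' = 2`
(`hasDerivAt_inverse_of_parallel`, `hasDerivAt_pairing`, `hasDerivAt_l`). Hence `f = l / 2`
increases at unit speed along the flow lines in `{σ ≠ 0}`.

The manifold is compact, so the smooth vector field `N` has a smooth global flow
(`exists_smooth_flow`). Smooth dependence on the initial value is obtained from the inverse
function theorem in a Banach space of curves: the curve `c` with `c' = s V(c)` and `c(0) = x` is
the solution of `c - s ∫₀ V ∘ c = x`, and the left-hand side is a smooth function of `s` and of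
the curve (`contDiff_superposition`, `exists_smooth_local_flow`). As `N` vanishes outside
`{σ ≠ 0}`, the points there are stationary, so that the flow preserves `{σ ≠ 0}`
(`integralCurve_mem_openOrbit`).

Every orbit in `{σ ≠ 0}` now meets the level set `{f = 0}` in exactly one point, namely
`φ_{-f(x)}(x)` for any point `x` of the orbit. The orbit space is therefore homeomorphic to
`{f = 0}`, a closed submanifold since `df` is `1` on `N`, and it inherits a smooth structure for
which the projection and the section are smooth (`exists_slice_manifold`). Then `x ↦ (f(x), π(x))`
is a diffeomorphism with inverse `(t, q) ↦ φ_t(s(q))`, which gives the principal bundle, the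
section and the trivialisation; `df` is invariant since `f ∘ φ_t = f + t`. The smooth structure is
unique because the projection of a principal bundle is a smooth surjection with smooth local
sections, so that the identity of the base is smooth both ways between two such structures
(`maximalAtlas_eq_of_isPrincipalRealBundle`).
-/

open Filter Topology

/-! ### Superposition operators on spaces of continuous functions -/

section Superposition

variable {K : Type*} [TopologicalSpace K] [CompactSpace K]

/-- The superposition operator `γ ↦ V ∘ γ` on the space `C(K, E)`. -/
def superposition {E F : Type*} [TopologicalSpace E] [TopologicalSpace F] (K : Type*)
    [TopologicalSpace K] (V : C(E, F)) : C(K, E) → C(K, F) :=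
  fun γ ↦ V.comp γ

/-- The pointwise application of a continuous bilinear map, as a continuous bilinear map
`C(K, G) × C(K, E) → C(K, F)`. -/
noncomputable def pointwiseBilin (K : Type*) [TopologicalSpace K] [CompactSpace K]
    {E F G : Type*} [NormedAddCommGroup E] [NormedSpace ℝ E] [NormedAddCommGroup F]
    [NormedSpace ℝ F] [NormedAddCommGroup G] [NormedSpace ℝ G] (B : G →L[ℝ] E →L[ℝ] F) :
    C(K, G) →L[ℝ] C(K, E) →L[ℝ] C(K, F) :=
  LinearMap.mkContinuous₂
    (LinearMap.mk₂ ℝ (fun (A : C(K, G)) (h : C(K, E)) ↦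
        (⟨fun t ↦ B (A t) (h t),
          (B.continuous.comp A.continuous).clm_apply h.continuous⟩ : C(K, F)))
      (fun A B h ↦ by ext t; simp) (fun r A h ↦ by ext t; simp)
      (fun A h k ↦ by ext t; simp) (fun r A h ↦ by ext t; simp)) ‖B‖ (fun A h ↦ by
    rw [ContinuousMap.norm_le _ (by positivity)]
    intro t
    refine (B.le_opNorm₂ (A t) (h t)).trans ?_
    gcongr
    · exact A.norm_coe_le_norm t
    · exact h.norm_coe_le_norm t)

/-- If `DV = B ∘ V'`, the derivative of `γ ↦ V ∘ γ` at `γ` is pointwise multiplication by `V' ∘ γ`.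
The uniformity over `K` in the Taylor estimate comes from the continuity of `γ ↦ V' ∘ γ` in the sup
norm, applied along the segments from `γ` to `γ + h`. -/
theorem hasFDerivAt_superposition {E F G : Type*} [NormedAddCommGroup E] [NormedSpace ℝ E]
    [NormedAddCommGroup F] [NormedSpace ℝ F] [NormedAddCommGroup G] [NormedSpace ℝ G]
    (B : G →L[ℝ] E →L[ℝ] F) (V : C(E, F)) (V' : C(E, G))
    (hV : ∀ x, HasFDerivAt V (B (V' x)) x) (γ : C(K, E)) :
    HasFDerivAt (superposition K V) (pointwiseBilin K B (superposition K V' γ)) γ := by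
  rw [hasFDerivAt_iff_isLittleO_nhds_zero, Asymptotics.isLittleO_iff]
  intro ε hε
  have hcont : ContinuousAt (superposition K V') γ :=
    (ContinuousMap.continuous_postcomp V').continuousAt
  have hB : 0 < ‖B‖ + 1 := by positivity
  obtain ⟨δ, hδ, H⟩ := Metric.continuousAt_iff.mp hcont (ε / (‖B‖ + 1)) (by positivity)
  filter_upwards [Metric.ball_mem_nhds (0 : C(K, E)) hδ] with h hh
  rw [mem_ball_zero_iff] at hh
  rw [ContinuousMap.norm_le _ (by positivity)]
  intro t
  have key : ∀ y ∈ segment ℝ (γ t) (γ t + h t), ‖B (V' y) - B (V' (γ t))‖ ≤ ε := by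
    intro y hy
    rw [segment_eq_image'] at hy
    obtain ⟨s, ⟨hs0, hs1⟩, rfl⟩ := hy
    have h1 : dist (γ + s • h) γ < δ := by
      rw [dist_eq_norm, add_sub_cancel_left, norm_smul, Real.norm_eq_abs, abs_of_nonneg hs0]
      exact (mul_le_of_le_one_left (norm_nonneg _) hs1).trans_lt hh
    have h2 := (H h1).le
    rw [dist_eq_norm] at h2
    have h3 := (ContinuousMap.norm_coe_le_norm
      (superposition K V' (γ + s • h) - superposition K V' γ) t).trans h2
    have h4 : ‖V' (γ t + s • h t) - V' (γ t)‖ ≤ ε / (‖B‖ + 1) := by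
      simpa [superposition] using h3
    rw [add_sub_cancel_left, ← map_sub]
    calc _ ≤ ‖B‖ * ‖V' (γ t + s • h t) - V' (γ t)‖ := B.le_opNorm _
      _ ≤ (‖B‖ + 1) * (ε / (‖B‖ + 1)) := by gcongr; linarith
      _ = ε := by field_simp
  have := Convex.norm_image_sub_le_of_norm_hasFDerivWithin_le' (f := V) (f' := fun y ↦ B (V' y))
    (φ := B (V' (γ t))) (fun y _ ↦ (hV y).hasFDerivWithinAt) key (convex_segment _ _)
    (left_mem_segment ℝ _ _) (right_mem_segment ℝ _ _)
  rw [add_sub_cancel_left] at this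
  exact this.trans (mul_le_mul_of_nonneg_left (h.norm_coe_le_norm t) hε.le)

theorem contDiff_succ_superposition {E F G : Type*} [NormedAddCommGroup E] [NormedSpace ℝ E]
    [NormedAddCommGroup F] [NormedSpace ℝ F] [NormedAddCommGroup G] [NormedSpace ℝ G]
    (B : G →L[ℝ] E →L[ℝ] F) {V : C(E, F)} {V' : C(E, G)}
    (hV : ∀ x, HasFDerivAt V (B (V' x)) x) {k : ℕ}
    (hk : ContDiff ℝ k (superposition K V')) :
    ContDiff ℝ (k + 1 : ℕ) (superposition K V) := by
  push_cast
  rw [contDiff_succ_iff_hasFDerivAt]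
  exact ⟨_, (pointwiseBilin K B).contDiff.comp hk, hasFDerivAt_superposition B V V' hV⟩

universe u in
/-- The two spaces lie in the same universe because the induction on the order of smoothness passes
from `V` with values in `F` to its derivative with values in `E →L[ℝ] F`. -/
theorem contDiff_superposition {E F : Type u} [NormedAddCommGroup E] [NormedSpace ℝ E]
    [NormedAddCommGroup F] [NormedSpace ℝ F] {V : C(E, F)} (hV : ContDiff ℝ ∞ V) :
    ContDiff ℝ ∞ (superposition K V) := by
  rw [contDiff_infty]
  intro k
  induction k generalizing F with
  | zero => exact contDiff_zero.mpr (ContinuousMap.continuous_postcomp V)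
  | succ k ih =>
    have hV' : ContDiff ℝ ∞ (fderiv ℝ V) := hV.fderiv_right le_rfl
    exact contDiff_succ_superposition (ContinuousLinearMap.id ℝ (E →L[ℝ] F))
      (V' := ⟨fderiv ℝ V, hV'.continuous⟩)
      (fun x ↦ (hV.differentiable (by simp) x).hasFDerivAt) (ih (F := E →L[ℝ] F) hV')

end Superposition

/-! ### Smooth dependence of integral curves on the initial point -/

section LocalFlow

variable {E : Type*} [NormedAddCommGroup E]

/-- The time interval on which rescaled integral curves are considered. -/
abbrev TimeInterval : Type := Icc (-2 : ℝ) 2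

/-- A continuous curve on `[-2, 2]`, extended to `ℝ` by constants. -/
noncomputable def extendCurve (g : C(TimeInterval, E)) (t : ℝ) : E :=
  g (projIcc (-2) 2 (by norm_num) t)

theorem continuous_extendCurve (g : C(TimeInterval, E)) : Continuous (extendCurve g) :=
  g.continuous.comp continuous_projIcc

theorem extendCurve_of_mem (g : C(TimeInterval, E)) {t : ℝ} (ht : t ∈ Icc (-2 : ℝ) 2) :
    extendCurve g t = g ⟨t, ht⟩ := by
  rw [extendCurve, projIcc_of_mem _ ht]

variable [NormedSpace ℝ E]

/-- The integral `g ↦ (t ↦ ∫₀ᵗ g)` as an operator on `C([-2, 2], E)`. -/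
noncomputable def primitive (E : Type*) [NormedAddCommGroup E] [NormedSpace ℝ E] :
    C(TimeInterval, E) →L[ℝ] C(TimeInterval, E) :=
  LinearMap.mkContinuous
    { toFun := fun g ↦ ⟨fun t ↦ ∫ s in (0 : ℝ)..t, extendCurve g s,
        (intervalIntegral.continuous_primitive
          (fun a b ↦ (continuous_extendCurve g).intervalIntegrable a b) 0).comp
          continuous_subtype_val⟩
      map_add' := fun g h ↦ by
        ext t
        exact intervalIntegral.integral_add ((continuous_extendCurve g).intervalIntegrable _ _)
          ((continuous_extendCurve h).intervalIntegrable _ _)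
      map_smul' := fun r g ↦ by
        ext t
        exact intervalIntegral.integral_smul r (extendCurve g) } 2 (fun g ↦ by
    rw [ContinuousMap.norm_le _ (by positivity)]
    intro t
    have h := intervalIntegral.norm_integral_le_of_norm_le_const (a := 0) (b := (t : ℝ))
      (f := extendCurve g) (C := ‖g‖) (fun s _ ↦ g.norm_coe_le_norm _)
    have ht : |(t : ℝ) - 0| ≤ 2 := by
      rw [sub_zero, abs_le]
      exact t.2
    calc _ ≤ ‖g‖ * |(t : ℝ) - 0| := h
      _ ≤ ‖g‖ * 2 := by gcongr
      _ = _ := mul_comm _ _)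

/-- Smooth dependence of the integral curves of a smooth vector field `V` on the initial point. For
small `s`, the curve `c = c (s, x)` with `c' = s V(c)`, `c 0 = x` exists on `(-2, 2)`, and its value
at time `1`, i.e. the flow of `V` at `(s, x)`, depends smoothly on `(s, x)`.

The curve solves `c - s ∫₀ V ∘ c = x` in `C([-2, 2], E)`; the map `(s, c) ↦ (s, c - s ∫₀ V ∘ c)` is
smooth and has an invertible derivative at every `(0, c)`, so the inverse function theorem
applies. -/
theorem exists_smooth_local_flow [CompleteSpace E] {V : E → E} (hV : ContDiff ℝ ∞ V) (x₀ : E) :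
    ∃ c : ℝ × E → ℝ → E, ContDiffAt ℝ ∞ (fun p ↦ c p 1) (0, x₀) ∧
      (∀ᶠ p in 𝓝 ((0 : ℝ), x₀), c p 0 = p.2 ∧
        ∀ t ∈ Ioo (-2 : ℝ) 2, HasDerivAt (c p) (p.1 • V (c p t)) t) ∧
      ∀ W ∈ 𝓝 x₀, ∀ᶠ p in 𝓝 ((0 : ℝ), x₀), ∀ t ∈ Ioo (-2 : ℝ) 2, c p t ∈ W := by
  let VC : C(E, E) := ⟨V, hV.continuous⟩
  let J : C(TimeInterval, E) → C(TimeInterval, E) :=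
    fun γ ↦ primitive E (superposition TimeInterval VC γ)
  have hJ : ContDiff ℝ ∞ J := (primitive E).contDiff.comp (contDiff_superposition hV)
  let G : ℝ × C(TimeInterval, E) → ℝ × C(TimeInterval, E) := fun q ↦ (q.1, q.2 - q.1 • J q.2)
  have hG : ContDiff ℝ ∞ G :=
    contDiff_fst.prodMk (contDiff_snd.sub (contDiff_fst.smul (hJ.comp contDiff_snd)))
  let γ₀ : C(TimeInterval, E) := ContinuousMap.const _ x₀
  -- the derivative of `G` at `(0, γ₀)`: `(r, η) ↦ (r, η - r J γ₀)`
  let L : (ℝ × C(TimeInterval, E)) ≃L[ℝ] (ℝ × C(TimeInterval, E)) :=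
    ContinuousLinearEquiv.equivOfInverse
      ((ContinuousLinearMap.fst ℝ ℝ _).prod
        (ContinuousLinearMap.snd ℝ ℝ _ - (ContinuousLinearMap.fst ℝ ℝ _).smulRight (J γ₀)))
      ((ContinuousLinearMap.fst ℝ ℝ _).prod
        (ContinuousLinearMap.snd ℝ ℝ _ + (ContinuousLinearMap.fst ℝ ℝ _).smulRight (J γ₀)))
      (fun q ↦ by simp) (fun q ↦ by simp)
  have hL : HasFDerivAt G (L : (ℝ × C(TimeInterval, E)) →L[ℝ] (ℝ × C(TimeInterval, E)))
      (0, γ₀) := by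
    have h1 : HasFDerivAt (fun q : ℝ × C(TimeInterval, E) ↦ q.1)
      (ContinuousLinearMap.fst ℝ ℝ C(TimeInterval, E)) (0, γ₀) := hasFDerivAt_fst
    have h2 : HasFDerivAt (fun q : ℝ × C(TimeInterval, E) ↦ q.2)
      (ContinuousLinearMap.snd ℝ ℝ C(TimeInterval, E)) (0, γ₀) := hasFDerivAt_snd
    have h3 := ((hJ.comp contDiff_snd).differentiable (by simp)
      ((0 : ℝ), γ₀)).hasFDerivAt
    refine (h1.prodMk (h2.sub (h1.smul h3))).congr_fderiv ?_
    refine ContinuousLinearMap.ext fun q ↦ ?_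
    simp [L]
  have hGat : ContDiffAt ℝ ∞ G (0, γ₀) := hG.contDiffAt
  have hn : (∞ : WithTop ℕ∞) ≠ 0 := by simp
  have hinv : ContDiffAt ℝ ∞ (hGat.localInverse hL hn) (0, γ₀) := by
    have := hGat.to_localInverse hL hn
    simpa [G] using this
  have hG0 : G (0, γ₀) = (0, γ₀) := by simp [G]
  have hval : hGat.localInverse hL hn (0, γ₀) = (0, γ₀) := by
    have := hGat.localInverse_apply_image hL hn
    rwa [hG0] at this
  have hright : ∀ᶠ q in 𝓝 ((0 : ℝ), γ₀), G (hGat.localInverse hL hn q) = q := by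
    have := (hGat.hasStrictFDerivAt' hL hn).eventually_right_inverse
    rwa [hG0] at this
  let ι : ℝ × E →L[ℝ] ℝ × C(TimeInterval, E) :=
    (ContinuousLinearMap.fst ℝ ℝ E).prod
      ((ContinuousLinearMap.const ℝ TimeInterval).comp (ContinuousLinearMap.snd ℝ ℝ E))
  have hι0 : ι (0, x₀) = (0, γ₀) := rfl
  let Γ : ℝ × E → C(TimeInterval, E) := fun p ↦ (hGat.localInverse hL hn (ι p)).2
  have hΓ : ContDiffAt ℝ ∞ Γ (0, x₀) :=
    contDiffAt_snd.comp _ (ContDiffAt.comp (0, x₀) (by rw [hι0]; exact hinv) ι.contDiff.contDiffAt)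
  have hΓ0 : Γ (0, x₀) = γ₀ := by simp only [Γ, hι0, hval]
  have hΓeq : ∀ᶠ p in 𝓝 ((0 : ℝ), x₀), ∀ t : TimeInterval,
      Γ p t = p.2 + p.1 • ∫ s in (0 : ℝ)..t, V (extendCurve (Γ p) s) := by
    have hc : Tendsto ι (𝓝 (0, x₀)) (𝓝 (0, γ₀)) := by
      rw [← hι0]
      exact ι.continuous.continuousAt
    filter_upwards [hc.eventually hright] with p hp t
    have e1 : (hGat.localInverse hL hn (ι p)).1 = p.1 := congrArg Prod.fst hp
    have e2 := congrArg (fun q ↦ q.2 t) hp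
    simp only [G, e1] at e2
    have e3 : Γ p t - p.1 • J (Γ p) t = p.2 := e2
    rw [← e3, sub_add_eq_add_sub]
    exact (add_sub_cancel_right _ _).symm
  refine ⟨fun p ↦ extendCurve (Γ p), ?_, ?_, ?_⟩
  · have h1 : (1 : ℝ) ∈ Icc (-2 : ℝ) 2 := by norm_num
    have : (fun p ↦ extendCurve (Γ p) 1) = fun p ↦ ContinuousMap.evalCLM ℝ ⟨1, h1⟩ (Γ p) := by
      funext p
      exact extendCurve_of_mem _ h1
    rw [this]
    exact (ContinuousMap.evalCLM ℝ (⟨1, h1⟩ : TimeInterval)).contDiff.contDiffAt.comp _ hΓ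
  · filter_upwards [hΓeq] with p hp
    refine ⟨?_, fun t ht ↦ ?_⟩
    · rw [extendCurve_of_mem _ (by norm_num : (0 : ℝ) ∈ Icc (-2 : ℝ) 2), hp]
      simp
    · have hcont : Continuous fun s ↦ V (extendCurve (Γ p) s) :=
        hV.continuous.comp (continuous_extendCurve _)
      have hd := ((hcont.integral_hasStrictDerivAt 0 t).hasDerivAt.const_smul p.1).const_add p.2
      refine hd.congr_of_eventuallyEq ?_
      filter_upwards [Ioo_mem_nhds ht.1 ht.2] with s hs
      rw [extendCurve_of_mem _ (Ioo_subset_Icc_self hs), hp]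
      rfl
  · intro W hW
    obtain ⟨r, hr, hrW⟩ := Metric.mem_nhds_iff.mp hW
    have hc := hΓ.continuousAt
    filter_upwards [hc (Metric.ball_mem_nhds _ hr)] with p hp t _
    rw [mem_preimage, hΓ0, Metric.mem_ball] at hp
    exact hrW ((ContinuousMap.dist_apply_le_dist (f := Γ p) (g := γ₀) _).trans_lt hp)

end LocalFlow

/-! ### The flow of a smooth vector field on a compact manifold -/

section ManifoldFlow

variable {E : Type*} [NormedAddCommGroup E] [NormedSpace ℝ E]

/-- A map that is smooth on a neighbourhood of `x₀` has the germ of a globally smooth map. -/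
theorem exists_contDiff_eventuallyEq [FiniteDimensional ℝ E] {F : Type*} [NormedAddCommGroup F]
    [NormedSpace ℝ F]
    {f : E → F} {s : Set E} {x₀ : E} (hf : ContDiffOn ℝ ∞ f s) (hs : s ∈ 𝓝 x₀) :
    ∃ g : E → F, ContDiff ℝ ∞ g ∧ g =ᶠ[𝓝 x₀] f := by
  obtain ⟨r, hr, hrs⟩ := Metric.nhds_basis_closedBall.mem_iff.mp (interior_mem_nhds.mpr hs)
  let χ : ContDiffBump x₀ := ⟨r / 2, r, by positivity, by linarith⟩
  refine ⟨fun x ↦ χ x • f x, ?_, ?_⟩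
  · rw [contDiff_iff_contDiffAt]
    intro x
    by_cases hx : x ∈ interior s
    · exact χ.contDiffAt.smul (hf.contDiffAt (mem_interior_iff_mem_nhds.mp hx))
    · have hx' : x ∉ tsupport χ := fun h ↦ hx (hrs (χ.tsupport_eq ▸ h))
      have h0 : (fun x ↦ χ x • f x) =ᶠ[𝓝 x] fun _ ↦ 0 := by
        filter_upwards [notMem_tsupport_iff_eventuallyEq.mp hx'] with y hy
        rw [hy, Pi.zero_apply, zero_smul]
      exact contDiffAt_const.congr_of_eventuallyEq h0
  · filter_upwards [χ.eventuallyEq_one] with x hx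
    rw [hx, Pi.one_apply, one_smul]

variable {M : Type*} [TopologicalSpace M] [ChartedSpace E M] [IsManifold 𝓘(ℝ, E) ∞ M]

/-- The coordinate expression, in the preferred chart at `x₀`, of a vector field. -/
noncomputable def chartVectorField (V : ∀ x : M, TangentSpace 𝓘(ℝ, E) x) (x₀ : M) (u : E) : E :=
  mfderiv 𝓘(ℝ, E) 𝓘(ℝ, E) (extChartAt 𝓘(ℝ, E) x₀) ((extChartAt 𝓘(ℝ, E) x₀).symm u)
    (V ((extChartAt 𝓘(ℝ, E) x₀).symm u))

theorem contDiffOn_chartVectorField {V : ∀ x : M, TangentSpace 𝓘(ℝ, E) x}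
    (hV : ContMDiff 𝓘(ℝ, E) 𝓘(ℝ, E).tangent ∞ (fun x ↦ (⟨x, V x⟩ : TangentBundle 𝓘(ℝ, E) M)))
    (x₀ : M) :
    ContDiffOn ℝ ∞ (chartVectorField V x₀) (extChartAt 𝓘(ℝ, E) x₀).target := by
  let e := trivializationAt E (TangentSpace 𝓘(ℝ, E) : M → Type _) x₀
  have h1 : ContMDiffOn 𝓘(ℝ, E) 𝓘(ℝ, E) ∞ (fun x ↦ (e ⟨x, V x⟩).2) e.baseSet :=
    e.contMDiffOn_section_baseSet_iff.mp hV.contMDiffOn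
  have hbase : e.baseSet = (chartAt E x₀).source := rfl
  rw [← contMDiffOn_iff_contDiffOn]
  have h2 := h1.comp (contMDiffOn_extChartAt_symm (I := 𝓘(ℝ, E)) (n := ∞) x₀) (fun u hu ↦ by
    rw [mem_preimage, hbase, ← extChartAt_source 𝓘(ℝ, E)]
    exact (extChartAt 𝓘(ℝ, E) x₀).map_target hu)
  refine h2.congr fun u hu ↦ ?_
  have hu' : (extChartAt 𝓘(ℝ, E) x₀).symm u ∈ (chartAt E x₀).source := by
    rw [← extChartAt_source 𝓘(ℝ, E)]
    exact (extChartAt 𝓘(ℝ, E) x₀).map_target hu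
  have h3 := DFunLike.congr_fun (TangentBundle.continuousLinearMapAt_trivializationAt
    (I := 𝓘(ℝ, E)) hu') (V ((extChartAt 𝓘(ℝ, E) x₀).symm u))
  refine h3.symm.trans ?_
  rw [Trivialization.continuousLinearMapAt_apply, Trivialization.coe_linearMapAt_of_mem]
  · rfl
  · exact hu'

/-- Coordinate curves with the velocity of the coordinate expression of `V` are integral curves. -/
theorem hasMFDerivAt_symm_comp {V : ∀ x : M, TangentSpace 𝓘(ℝ, E) x} {x₀ : M} {c : ℝ → E} {t s : ℝ}
    (ht : c t ∈ (extChartAt 𝓘(ℝ, E) x₀).target)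
    (hc : HasDerivAt c (s • chartVectorField V x₀ (c t)) t) :
    HasMFDerivAt 𝓘(ℝ, ℝ) 𝓘(ℝ, E) ((extChartAt 𝓘(ℝ, E) x₀).symm ∘ c) t
      ((1 : ℝ →L[ℝ] ℝ).smulRight (s • V ((extChartAt 𝓘(ℝ, E) x₀).symm (c t)))) := by
  have h1 : MDifferentiableAt 𝓘(ℝ, E) 𝓘(ℝ, E) (extChartAt 𝓘(ℝ, E) x₀).symm (c t) := by
    have := mdifferentiableWithinAt_extChartAt_symm (I := 𝓘(ℝ, E)) ht
    rwa [ModelWithCorners.range_eq_univ, mdifferentiableWithinAt_univ] at this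
  have h2 := mfderivWithin_extChartAt_symm_comp_mfderiv_extChartAt (I := 𝓘(ℝ, E)) ht
  rw [ModelWithCorners.range_eq_univ, mfderivWithin_univ] at h2
  have h3 := h1.hasMFDerivAt.comp t hc.hasFDerivAt.hasMFDerivAt
  refine h3.congr_mfderiv ?_
  refine ContinuousLinearMap.ext fun (r : ℝ) ↦ ?_
  have h4 := DFunLike.congr_fun h2 (V ((extChartAt 𝓘(ℝ, E) x₀).symm (c t)))
  let D : E →L[ℝ] E := mfderiv 𝓘(ℝ, E) 𝓘(ℝ, E) (extChartAt 𝓘(ℝ, E) x₀).symm (c t)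
  change D (r • s • chartVectorField V x₀ (c t)) =
    r • s • (show E from V ((extChartAt 𝓘(ℝ, E) x₀).symm (c t)))
  rw [map_smul, map_smul]
  exact congrArg (fun w : E ↦ r • s • w) h4

/-- The local flow of a smooth vector field on a manifold, with its smooth dependence on time and on
the initial point; the time is rescaled as in `exists_smooth_local_flow`. -/
theorem exists_smooth_local_flow_manifold [FiniteDimensional ℝ E]
    {V : ∀ x : M, TangentSpace 𝓘(ℝ, E) x}
    (hV : ContMDiff 𝓘(ℝ, E) 𝓘(ℝ, E).tangent ∞ (fun x ↦ (⟨x, V x⟩ : TangentBundle 𝓘(ℝ, E) M)))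
    (x₀ : M) :
    ∃ c : ℝ × M → ℝ → M,
      ContMDiffAt (𝓘(ℝ, ℝ).prod 𝓘(ℝ, E)) 𝓘(ℝ, E) ∞ (fun p ↦ c p 1) ((0 : ℝ), x₀) ∧
      ∀ᶠ p in 𝓝 ((0 : ℝ), x₀), c p 0 = p.2 ∧
        IsMIntegralCurveOn (I := 𝓘(ℝ, E)) (c p) (p.1 • V) (Ioo (-2) 2) := by
  have : CompleteSpace E := FiniteDimensional.complete ℝ E
  obtain ⟨g, hg, hgV⟩ := exists_contDiff_eventuallyEq (contDiffOn_chartVectorField hV x₀)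
    (extChartAt_target_mem_nhds (I := 𝓘(ℝ, E)) x₀)
  obtain ⟨c, hc1, hc2, hc3⟩ := exists_smooth_local_flow hg (extChartAt 𝓘(ℝ, E) x₀ x₀)
  let κ : ℝ × M → ℝ × E := fun p ↦ (p.1, extChartAt 𝓘(ℝ, E) x₀ p.2)
  have hκ : ContMDiffAt (𝓘(ℝ, ℝ).prod 𝓘(ℝ, E)) 𝓘(ℝ, ℝ × E) ∞ κ ((0 : ℝ), x₀) :=
    contMDiffAt_fst.prodMk_space
      ((contMDiffAt_extChartAt (n := ∞)).comp ((0 : ℝ), x₀) contMDiffAt_snd)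
  have hκt : Tendsto κ (𝓝 (0, x₀)) (𝓝 (0, extChartAt 𝓘(ℝ, E) x₀ x₀)) := hκ.continuousAt
  have hin := hc3 _ (inter_mem hgV (extChartAt_target_mem_nhds (I := 𝓘(ℝ, E)) x₀))
  refine ⟨fun p ↦ (extChartAt 𝓘(ℝ, E) x₀).symm ∘ c (κ p), ?_, ?_⟩
  · have h0 : c (κ (0, x₀)) 1 ∈ (extChartAt 𝓘(ℝ, E) x₀).target :=
      (hin.self_of_nhds 1 (by norm_num)).2
    have h1 : ContMDiffAt 𝓘(ℝ, ℝ × E) 𝓘(ℝ, E) ∞ (fun p ↦ c p 1) (κ (0, x₀)) := hc1.contMDiffAt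
    have h2 : ContMDiffAt 𝓘(ℝ, E) 𝓘(ℝ, E) ∞ (extChartAt 𝓘(ℝ, E) x₀).symm (c (κ (0, x₀)) 1) :=
      (contMDiffOn_extChartAt_symm x₀).contMDiffAt
        ((isOpen_extChartAt_target x₀).mem_nhds h0)
    exact h2.comp ((0 : ℝ), x₀) (h1.comp ((0 : ℝ), x₀) hκ)
  · have hsrc : ∀ᶠ p in 𝓝 ((0 : ℝ), x₀), p.2 ∈ (extChartAt 𝓘(ℝ, E) x₀).source :=
      continuousAt_snd.eventually (extChartAt_source_mem_nhds (I := 𝓘(ℝ, E)) x₀)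
    filter_upwards [hκt.eventually hc2, hκt.eventually hin, hsrc] with p hp hpin hps
    refine ⟨?_, fun t ht ↦ ?_⟩
    · rw [Function.comp_apply, hp.1]
      exact (extChartAt 𝓘(ℝ, E) x₀).left_inv hps
    · have hd := hp.2 t ht
      rw [show g (c (κ p) t) = _ from (hpin t ht).1] at hd
      exact (hasMFDerivAt_symm_comp (hpin t ht).2 hd).hasMFDerivWithinAt

variable [T2Space M] [CompactSpace M]

/-- A smooth vector field on a compact manifold has a global flow, which is smooth. -/
theorem exists_smooth_flow [FiniteDimensional ℝ E] {V : ∀ x : M, TangentSpace 𝓘(ℝ, E) x}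
    (hV : ContMDiff 𝓘(ℝ, E) 𝓘(ℝ, E).tangent ∞ (fun x ↦ (⟨x, V x⟩ : TangentBundle 𝓘(ℝ, E) M))) :
    ∃ φ : ℝ → M → M, (∀ x, φ 0 x = x) ∧
      (∀ x, IsMIntegralCurve (I := 𝓘(ℝ, E)) (fun t ↦ φ t x) V) ∧
      (∀ s t x, φ (s + t) x = φ s (φ t x)) ∧
      ContMDiff (𝓘(ℝ, ℝ).prod 𝓘(ℝ, E)) 𝓘(ℝ, E) ∞ (fun p : ℝ × M ↦ φ p.1 p.2) := by
  have : CompleteSpace E := FiniteDimensional.complete ℝ E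
  have : IsManifold 𝓘(ℝ, E) 1 M := IsManifold.of_le (n := ∞) (by simp)
  have hV1 : ContMDiff 𝓘(ℝ, E) 𝓘(ℝ, E).tangent 1
    (fun x ↦ (⟨x, V x⟩ : TangentBundle 𝓘(ℝ, E) M)) := hV.of_le (by simp)
  choose c hc1 hc2 using fun x₀ : M ↦ exists_smooth_local_flow_manifold hV x₀
  -- a uniform time, from compactness
  have huni : ∃ ε > (0 : ℝ), ∀ x : M, ∃ x₀ : M, ∀ t, |t| < ε → c x₀ (t, x) 0 = x ∧
      IsMIntegralCurveOn (I := 𝓘(ℝ, E)) (c x₀ (t, x)) (t • V) (Ioo (-2) 2) := by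
    have h : ∀ x₀ : M, ∃ ε > (0 : ℝ), ∀ᶠ x in 𝓝 x₀, ∀ t, |t| < ε → c x₀ (t, x) 0 = x ∧
        IsMIntegralCurveOn (I := 𝓘(ℝ, E)) (c x₀ (t, x)) (t • V) (Ioo (-2) 2) := by
      intro x₀
      have h := hc2 x₀
      rw [nhds_prod_eq] at h
      obtain ⟨p, hp, q, hq, hpq⟩ := eventually_prod_iff.mp h
      obtain ⟨ε, hε, hb⟩ := Metric.eventually_nhds_iff.mp hp
      refine ⟨ε, hε, hq.mono fun x hx t ht ↦ hpq (hb ?_) hx⟩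
      rwa [Real.dist_eq, sub_zero]
    choose ε hε hε' using h
    obtain ⟨T, -, hT⟩ := isCompact_univ.elim_nhds_subcover (fun x₀ ↦ {x | ∀ t, |t| < ε x₀ →
      c x₀ (t, x) 0 = x ∧
      IsMIntegralCurveOn (I := 𝓘(ℝ, E)) (c x₀ (t, x)) (t • V) (Ioo (-2) 2)}) (fun x₀ _ ↦ hε' x₀)
    rcases isEmpty_or_nonempty M with hM | hM
    · exact ⟨1, one_pos, fun x ↦ (hM.false x).elim⟩
    have hTne : T.Nonempty := by
      obtain ⟨x⟩ := hM
      obtain ⟨x₀, hx₀, -⟩ := mem_iUnion₂.mp (hT (mem_univ x))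
      exact ⟨x₀, hx₀⟩
    refine ⟨T.inf' hTne ε, ?_, fun x ↦ ?_⟩
    · rw [gt_iff_lt, Finset.lt_inf'_iff]
      exact fun x₀ _ ↦ hε x₀
    · obtain ⟨x₀, hx₀, hx⟩ := mem_iUnion₂.mp (hT (mem_univ x))
      exact ⟨x₀, fun t ht ↦ hx t (ht.trans_le (Finset.inf'_le _ hx₀))⟩
  obtain ⟨ε, hε, hunif⟩ := huni
  -- integral curves on the intervals `(-ε, ε)`, and thus on `ℝ`
  have hex : ∀ x : M, ∃ γ : ℝ → M, γ 0 = x ∧ IsMIntegralCurve (I := 𝓘(ℝ, E)) γ V := by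
    refine exists_isMIntegralCurve_of_isMIntegralCurveOn hV1 hε fun x ↦ ?_
    obtain ⟨x₀, hx₀⟩ := hunif x
    obtain ⟨h0, h1⟩ := hx₀ (ε / 2) (by rw [abs_of_pos (by positivity)]; linarith)
    refine ⟨c x₀ (ε / 2, x) ∘ (· * (ε / 2)⁻¹), by simp [h0], ?_⟩
    have h2 := h1.comp_mul (ε / 2)⁻¹
    rw [smul_smul, inv_mul_cancel₀ (by positivity), one_smul] at h2
    refine h2.mono fun t ht ↦ ?_
    have : t * (ε / 2)⁻¹ = 2 * t / ε := by field_simp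
    change -2 < t * (ε / 2)⁻¹ ∧ t * (ε / 2)⁻¹ < 2
    rw [this, lt_div_iff₀ hε, div_lt_iff₀ hε]
    constructor <;> linarith [ht.1, ht.2]
  choose γ hγ0 hγ using hex
  let φ : ℝ → M → M := fun t x ↦ γ x t
  have hadd : ∀ s t x, φ (s + t) x = φ s (φ t x) := by
    intro s t x
    have h1 := (hγ x).comp_add t
    have h2 := isMIntegralCurve_Ioo_eq_of_contMDiff_boundaryless (t₀ := 0) hV1 h1
      (hγ (φ t x)) (by rw [hγ0]; simp [φ])
    exact congrFun h2 s
  -- by uniqueness, `φ` agrees near `(0, x₀)` with the smooth local flow at `x₀`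
  have hloc : ∀ x₀ : M, ContMDiffAt (𝓘(ℝ, ℝ).prod 𝓘(ℝ, E)) 𝓘(ℝ, E) ∞
      (fun p : ℝ × M ↦ φ p.1 p.2) ((0 : ℝ), x₀) := by
    intro x₀
    refine (hc1 x₀).congr_of_eventuallyEq ?_
    filter_upwards [hc2 x₀] with p hp
    have h1 := ((hγ p.2).comp_mul p.1).isMIntegralCurveOn (Ioo (-2) 2)
    have hsm : ContMDiff 𝓘(ℝ, E) 𝓘(ℝ, E).tangent 1
        (fun x ↦ (⟨x, (p.1 • V) x⟩ : TangentBundle 𝓘(ℝ, E) M)) :=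
      contMDiff_const.smul_section hV1
    have h2 := isMIntegralCurveOn_Ioo_eqOn_of_contMDiff_boundaryless (t₀ := 0) (by norm_num)
      hsm h1 hp.2 (by simp [hp.1, hγ0])
    have h3 := h2 (show (1 : ℝ) ∈ Ioo (-2 : ℝ) 2 by norm_num)
    simpa [φ] using h3
  -- `C^m`-smoothness at a point spreads to a neighbourhood of it for finite `m` only
  refine ⟨φ, hγ0, hγ, hadd, contMDiff_infty.mpr fun m ↦ ?_⟩
  have hm : ((m : ℕ∞) : WithTop ℕ∞) ≤ ∞ := by exact_mod_cast le_top
  have : IsManifold 𝓘(ℝ, E) m M := IsManifold.of_le (n := ∞) hm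
  -- `C^m`-smoothness for small times, uniformly in the point
  obtain ⟨a, ha, hsm⟩ : ∃ a > (0 : ℝ), ContMDiffOn (𝓘(ℝ, ℝ).prod 𝓘(ℝ, E)) 𝓘(ℝ, E) m
      (fun p : ℝ × M ↦ φ p.1 p.2) (Ioo (-a) a ×ˢ univ) := by
    have h : ∀ x ∈ (univ : Set M), ∀ᶠ p : ℝ × M in 𝓝 0 ×ˢ 𝓝 x,
        ContMDiffAt (𝓘(ℝ, ℝ).prod 𝓘(ℝ, E)) 𝓘(ℝ, E) m (fun p : ℝ × M ↦ φ p.1 p.2) p := by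
      intro x _
      rw [← nhds_prod_eq]
      exact (contMDiffAt_iff_contMDiffAt_nhds (by simp)).mp ((hloc x).of_le hm)
    have h1 : ∀ᶠ t in 𝓝 (0 : ℝ), ∀ x ∈ (univ : Set M),
        ContMDiffAt (𝓘(ℝ, ℝ).prod 𝓘(ℝ, E)) 𝓘(ℝ, E) m (fun p : ℝ × M ↦ φ p.1 p.2) (t, x) :=
      isCompact_univ.eventually_forall_of_forall_eventually fun x hx ↦ by
        rw [nhds_prod_eq]
        exact h x hx
    obtain ⟨a, ha, hb⟩ := Metric.eventually_nhds_iff.mp h1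
    refine ⟨a, ha, fun p hp ↦ (hb ?_ p.2 trivial).contMDiffWithinAt⟩
    rw [Real.dist_eq, sub_zero, abs_lt]
    exact hp.1
  -- `φ t = φ (t / 2) ∘ φ (t / 2)` doubles the interval of smoothness
  have hdouble : ∀ a : ℝ, ContMDiffOn (𝓘(ℝ, ℝ).prod 𝓘(ℝ, E)) 𝓘(ℝ, E) m
      (fun p : ℝ × M ↦ φ p.1 p.2) (Ioo (-a) a ×ˢ univ) →
      ContMDiffOn (𝓘(ℝ, ℝ).prod 𝓘(ℝ, E)) 𝓘(ℝ, E) m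
      (fun p : ℝ × M ↦ φ p.1 p.2) (Ioo (-(2 * a)) (2 * a) ×ˢ univ) := by
    intro a ha
    have hhalf : ContMDiff (𝓘(ℝ, ℝ).prod 𝓘(ℝ, E)) 𝓘(ℝ, ℝ) m (fun p : ℝ × M ↦ p.1 / 2) := by
      have : ContMDiff 𝓘(ℝ, ℝ) 𝓘(ℝ, ℝ) m (fun t : ℝ ↦ t / 2) :=
        (contDiff_id.div_const 2).contMDiff
      exact this.comp contMDiff_fst
    have hmem : ∀ p ∈ Ioo (-(2 * a)) (2 * a) ×ˢ (univ : Set M), p.1 / 2 ∈ Ioo (-a) a := by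
      rintro p ⟨⟨h1, h2⟩, -⟩
      constructor <;> linarith
    have h1 : ContMDiffOn (𝓘(ℝ, ℝ).prod 𝓘(ℝ, E)) 𝓘(ℝ, E) m
        (fun p : ℝ × M ↦ φ (p.1 / 2) p.2) (Ioo (-(2 * a)) (2 * a) ×ˢ univ) :=
      ha.comp (hhalf.prodMk contMDiff_snd).contMDiffOn (fun p hp ↦ ⟨hmem p hp, trivial⟩)
    have h2 := ha.comp (hhalf.contMDiffOn.prodMk h1) (fun p hp ↦ ⟨hmem p hp, trivial⟩)
    refine h2.congr fun p _ ↦ ?_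
    rw [Function.comp_apply, ← hadd, add_halves]
  have hpow : ∀ k : ℕ, ContMDiffOn (𝓘(ℝ, ℝ).prod 𝓘(ℝ, E)) 𝓘(ℝ, E) m
      (fun p : ℝ × M ↦ φ p.1 p.2) (Ioo (-(2 ^ k * a)) (2 ^ k * a) ×ˢ univ) := by
    intro k
    induction k with
    | zero => simpa using hsm
    | succ k ih =>
      have := hdouble _ ih
      rwa [← mul_assoc, ← pow_succ'] at this
  intro p
  obtain ⟨k, hk⟩ := pow_unbounded_of_one_lt (|p.1| / a) one_lt_two
  have hk' : |p.1| < 2 ^ k * a := by rwa [div_lt_iff₀ ha] at hk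
  exact (hpow k).contMDiffAt (prod_mem_nhds (Ioo_mem_nhds (abs_lt.mp hk').1 (abs_lt.mp hk').2)
    univ_mem)

end ManifoldFlow

/-! ### The smooth structure of a quotient that is represented by a level set -/

section Slice

variable {E : Type*} [NormedAddCommGroup E] [NormedSpace ℝ E]
  {F : Type*} [NormedAddCommGroup F] [NormedSpace ℝ F]

/-- A nonzero linear form is the first component of a linear isomorphism with a product. -/
theorem exists_equiv_prod_fst_eq [FiniteDimensional ℝ E] [FiniteDimensional ℝ F]
    (hEF : finrank ℝ E = finrank ℝ F + 1) {A : E →L[ℝ] ℝ}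
    {v : E} (hv : A v ≠ 0) : ∃ L : E ≃L[ℝ] ℝ × F, ∀ w, (L w).1 = A w := by
  have hsurj : Function.Surjective A.toLinearMap := by
    intro r
    exact ⟨(r / A v) • v, by simp [hv]⟩
  have hker : finrank ℝ (LinearMap.ker A.toLinearMap) = finrank ℝ F := by
    have h1 := A.toLinearMap.finrank_range_add_finrank_ker
    rw [LinearMap.range_eq_top.mpr hsurj, finrank_top, finrank_self] at h1
    omega
  let e : LinearMap.ker A.toLinearMap ≃ₗ[ℝ] F := LinearEquiv.ofFinrankEq _ _ hker
  let pker : E →ₗ[ℝ] LinearMap.ker A.toLinearMap :=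
    LinearMap.codRestrict _ (LinearMap.id - (A.toLinearMap.smulRight ((A v)⁻¹ • v))) (by
      intro w
      simp [hv])
  let L : E →ₗ[ℝ] ℝ × F := A.toLinearMap.prod (e.toLinearMap ∘ₗ pker)
  have hinj : Function.Injective L := by
    rw [injective_iff_map_eq_zero]
    intro w hw
    have h1 : A w = 0 := congrArg Prod.fst hw
    have h2 : e (pker w) = 0 := congrArg Prod.snd hw
    have h3 : pker w = 0 := by simpa using h2
    have h4 : w - A w • (A v)⁻¹ • v = 0 := congrArg Subtype.val h3
    simpa [h1] using h4
  have hdim : finrank ℝ E = finrank ℝ (ℝ × F) := by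
    rw [finrank_prod, finrank_self, hEF, add_comm]
  exact ⟨(LinearEquiv.ofInjectiveOfFinrankEq L hinj hdim).toContinuousLinearEquiv, fun w ↦ rfl⟩

variable {P : Type*} [TopologicalSpace P] [ChartedSpace E P]

variable (E F) in
/-- Charts of `P` with values in `ℝ × F` whose first component is the function `f`. -/
structure AdaptedChart (f : P → ℝ) where
  /-- the chart -/
  toChart : OpenPartialHomeomorph P (ℝ × F)
  smooth : ContMDiffOn 𝓘(ℝ, E) 𝓘(ℝ, ℝ × F) ∞ toChart toChart.source
  smooth_symm : ContMDiffOn 𝓘(ℝ, ℝ × F) 𝓘(ℝ, E) ∞ toChart.symm toChart.target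
  fst_eq : ∀ p ∈ toChart.source, (toChart p).1 = f p

/-- Adapted charts exist where `f` has a nonzero derivative, by the inverse function theorem. -/
theorem exists_adaptedChart [FiniteDimensional ℝ E] [FiniteDimensional ℝ F]
    [IsManifold 𝓘(ℝ, E) ∞ P] (hEF : finrank ℝ E = finrank ℝ F + 1)
    {f : P → ℝ} (hf : ContMDiff 𝓘(ℝ, E) 𝓘(ℝ, ℝ) ∞ f) {x₀ : P}
    {v : TangentSpace 𝓘(ℝ, E) x₀} (hv : mvfderiv 𝓘(ℝ, E) f x₀ v ≠ 0) :
    ∃ κ : AdaptedChart E F f, x₀ ∈ κ.toChart.source := by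
  have : CompleteSpace E := FiniteDimensional.complete ℝ E
  let c := chartAt E x₀
  let g : E → ℝ := f ∘ c.symm
  have hc : ContMDiffOn 𝓘(ℝ, E) 𝓘(ℝ, E) ∞ c c.source := contMDiffOn_chart
  have hcs : ContMDiffOn 𝓘(ℝ, E) 𝓘(ℝ, E) ∞ c.symm c.target := contMDiffOn_chart_symm
  have hx₀ : c x₀ ∈ c.target := mem_chart_target E x₀
  have hg : ContDiffOn ℝ ∞ g c.target :=
    contMDiffOn_iff_contDiffOn.mp (hf.comp_contMDiffOn hcs)
  have hgat : ∀ u ∈ c.target, ContDiffAt ℝ ∞ g u :=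
    fun u hu ↦ hg.contDiffAt (c.open_target.mem_nhds hu)
  have hA : (fderiv ℝ g (c x₀) : E → ℝ) (show E from v) ≠ 0 := by
    have h1 : fderivWithin ℝ (writtenInExtChartAt 𝓘(ℝ, E) 𝓘(ℝ, ℝ) x₀ f) (range 𝓘(ℝ, E))
        (extChartAt 𝓘(ℝ, E) x₀ x₀) = fderiv ℝ g (c x₀) := by
      simp only [ModelWithCorners.range_eq_univ, fderivWithin_univ]
      rfl
    have h2 := (hf.mdifferentiable (by simp) x₀).mfderiv.trans h1
    exact fun h ↦ hv ((DFunLike.congr_fun h2 v).trans h)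
  obtain ⟨L, hL⟩ := exists_equiv_prod_fst_eq (F := F) hEF hA
  let B : E →L[ℝ] F := (ContinuousLinearMap.snd ℝ ℝ F).comp (L : E →L[ℝ] ℝ × F)
  let G : E → ℝ × F := fun u ↦ (g u, B u)
  have hG : ∀ u ∈ c.target, ContDiffAt ℝ ∞ G u :=
    fun u hu ↦ (hgat u hu).prodMk B.contDiff.contDiffAt
  have hGd : HasFDerivAt G (L : E →L[ℝ] ℝ × F) (c x₀) := by
    have h1 := ((hgat _ hx₀).differentiableAt (by simp)).hasFDerivAt.prodMk
      (B.hasFDerivAt (x := c x₀))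
    refine h1.congr_fderiv (ContinuousLinearMap.ext fun w ↦ ?_)
    exact Prod.ext (hL w).symm rfl
  have hn : (∞ : WithTop ℕ∞) ≠ 0 := by simp
  -- where the derivative of `G` is invertible, the local inverse of `G` is smooth
  let S : Set E :=
    c.target ∩ fderiv ℝ G ⁻¹' range ((↑) : (E ≃L[ℝ] ℝ × F) → E →L[ℝ] ℝ × F)
  have hS : S ∈ 𝓝 (c x₀) := by
    refine inter_mem (c.open_target.mem_nhds hx₀) ?_
    have hcont : ContinuousAt (fderiv ℝ G) (c x₀) :=
      ((hG _ hx₀).fderiv_right (m := 0) (by simp)).continuousAt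
    refine hcont.preimage_mem_nhds ?_
    rw [hGd.fderiv]
    exact ContinuousLinearEquiv.nhds L
  let κ₀ : OpenPartialHomeomorph E (ℝ × F) :=
    ((hG _ hx₀).toOpenPartialHomeomorph G hGd hn).restr S
  have hκ₀ : (κ₀ : E → ℝ × F) = G := rfl
  have hsrc : ∀ u ∈ κ₀.source, u ∈ S := fun u hu ↦ interior_subset hu.2
  have hmem : c x₀ ∈ κ₀.source :=
    ⟨(hG _ hx₀).mem_toOpenPartialHomeomorph_source hGd hn, mem_interior_iff_mem_nhds.mpr hS⟩
  have hκsymm : ContDiffOn ℝ ∞ κ₀.symm κ₀.target := by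
    intro y hy
    obtain ⟨hu, e, he⟩ := hsrc _ (κ₀.map_target hy)
    refine (κ₀.contDiffAt_symm (f₀' := e) hy ?_ (hG _ hu)).contDiffWithinAt
    rw [he]
    exact ((hG _ hu).differentiableAt (by simp)).hasFDerivAt
  refine ⟨⟨c.trans κ₀, ?_, ?_, ?_⟩, ⟨mem_chart_source E x₀, hmem⟩⟩
  · have h1 : ContMDiffOn 𝓘(ℝ, E) 𝓘(ℝ, ℝ × F) ∞ κ₀ κ₀.source :=
      fun u hu ↦ (hG u (hsrc u hu).1).contMDiffAt.contMDiffWithinAt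
    exact h1.comp (hc.mono fun p hp ↦ hp.1) (fun p hp ↦ hp.2)
  · exact hcs.comp (hκsymm.contMDiffOn.mono fun y hy ↦ hy.1) (fun y hy ↦ hy.2)
  · rintro p ⟨hp, -⟩
    change f (c.symm (c p)) = f p
    rw [c.left_inv hp]

/-- `s` identifies the space `Q` with the zero set of `f` in `P`, as a topological space, and
`s ∘ pr` is a retraction of `P` onto this zero set. -/
structure IsSlice {Q : Type*} [TopologicalSpace Q] (f : P → ℝ) (pr : P → Q) (s : Q → P) :
    Prop where
  continuous_proj : Continuous pr
  continuous_section : Continuous s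
  proj_section : ∀ q, pr (s q) = q
  apply_section : ∀ q, f (s q) = 0
  section_proj : ∀ p, f p = 0 → s (pr p) = p

variable {Q : Type*} [TopologicalSpace Q] {f : P → ℝ} {pr : P → Q} {s : Q → P}

theorem IsSlice.t2Space [T2Space P] (h : IsSlice f pr s) : T2Space Q :=
  have hleft : Function.LeftInverse pr s := h.proj_section
  T2Space.of_injective_continuous hleft.injective h.continuous_section

theorem IsSlice.secondCountableTopology [SecondCountableTopology P] (h : IsSlice f pr s) :
    SecondCountableTopology Q :=
  have hleft : Function.LeftInverse pr s := h.proj_section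
  (hleft.isEmbedding h.continuous_proj h.continuous_section).secondCountableTopology

/-- The chart of `Q` induced by an adapted chart: the restriction of the adapted chart to the zero
set of `f`. -/
def sliceChart (h : IsSlice f pr s) (κ : AdaptedChart E F f) : OpenPartialHomeomorph Q F where
  toFun q := (κ.toChart (s q)).2
  invFun w := pr (κ.toChart.symm (0, w))
  source := s ⁻¹' κ.toChart.source
  target := (fun w ↦ ((0 : ℝ), w)) ⁻¹' κ.toChart.target
  map_source' q hq := by
    have h1 := κ.toChart.map_source hq
    have h2 := κ.fst_eq _ hq
    rw [h.apply_section] at h2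
    change ((0 : ℝ), (κ.toChart (s q)).2) ∈ κ.toChart.target
    rwa [← h2]
  map_target' w hw := by
    have h1 := κ.toChart.map_target hw
    have h2 := κ.fst_eq _ h1
    rw [κ.toChart.right_inv hw] at h2
    change s (pr _) ∈ κ.toChart.source
    rwa [h.section_proj _ h2.symm]
  left_inv' q hq := by
    have h2 := κ.fst_eq _ hq
    rw [h.apply_section] at h2
    rw [show ((0 : ℝ), (κ.toChart (s q)).2) = κ.toChart (s q) by rw [← h2],
      κ.toChart.left_inv hq, h.proj_section]
  right_inv' w hw := by
    have h1 := κ.toChart.map_target hw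
    have h2 := κ.fst_eq _ h1
    rw [κ.toChart.right_inv hw] at h2
    rw [h.section_proj _ h2.symm, κ.toChart.right_inv hw]
  open_source := κ.toChart.open_source.preimage h.continuous_section
  open_target := κ.toChart.open_target.preimage (by fun_prop)
  continuousOn_toFun := continuous_snd.comp_continuousOn
    (κ.toChart.continuousOn.comp h.continuous_section.continuousOn fun _ hq ↦ hq)
  continuousOn_invFun := h.continuous_proj.comp_continuousOn
    (κ.toChart.symm.continuousOn.comp (by fun_prop) fun _ hw ↦ hw)

theorem section_sliceChart_symm (h : IsSlice f pr s) (κ : AdaptedChart E F f) {w : F}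
    (hw : w ∈ (sliceChart h κ).target) :
    s ((sliceChart h κ).symm w) = κ.toChart.symm (0, w) := by
  have h2 := κ.fst_eq _ (κ.toChart.map_target hw)
  rw [κ.toChart.right_inv hw] at h2
  exact h.section_proj _ h2.symm

theorem contMDiffOn_section_comp_sliceChart_symm (h : IsSlice f pr s) (κ : AdaptedChart E F f) :
    ContMDiffOn 𝓘(ℝ, F) 𝓘(ℝ, E) ∞ (s ∘ (sliceChart h κ).symm) (sliceChart h κ).target := by
  have h1 : ContMDiff 𝓘(ℝ, F) 𝓘(ℝ, ℝ × F) ∞ (fun w : F ↦ ((0 : ℝ), w)) :=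
    (contDiff_const.prodMk contDiff_id).contMDiff
  refine (κ.smooth_symm.comp h1.contMDiffOn fun w hw ↦ hw).congr fun w hw ↦ ?_
  exact section_sliceChart_symm h κ hw

/-- If the zero set of `f` is regular, `Q` carries a smooth structure for which the section `s` is
smooth; the projection is smooth if the retraction `s ∘ pr` is. -/
theorem exists_slice_manifold [FiniteDimensional ℝ E] [FiniteDimensional ℝ F]
    [IsManifold 𝓘(ℝ, E) ∞ P] (hEF : finrank ℝ E = finrank ℝ F + 1)
    (h : IsSlice f pr s) (hf : ContMDiff 𝓘(ℝ, E) 𝓘(ℝ, ℝ) ∞ f)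
    (hreg : ∀ p, ∃ v : TangentSpace 𝓘(ℝ, E) p, mvfderiv 𝓘(ℝ, E) f p v ≠ 0)
    (hr : ContMDiff 𝓘(ℝ, E) 𝓘(ℝ, E) ∞ (s ∘ pr)) :
    ∃ _cs : ChartedSpace F Q, IsManifold 𝓘(ℝ, F) ∞ Q ∧
      ContMDiff 𝓘(ℝ, F) 𝓘(ℝ, E) ∞ s ∧ ContMDiff 𝓘(ℝ, E) 𝓘(ℝ, F) ∞ pr := by
  have hex : ∀ p : P, ∃ κ : AdaptedChart E F f, p ∈ κ.toChart.source := fun p ↦ by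
    obtain ⟨v, hv⟩ := hreg p
    exact exists_adaptedChart hEF hf hv
  choose κ hκ using hex
  let _cs : ChartedSpace F Q :=
    { atlas := range fun q ↦ sliceChart h (κ (s q))
      chartAt := fun q ↦ sliceChart h (κ (s q))
      mem_chart_source := fun q ↦ hκ (s q)
      chart_mem_atlas := fun q ↦ mem_range_self q }
  have hsnd : ContMDiff 𝓘(ℝ, ℝ × F) 𝓘(ℝ, F) ∞ (Prod.snd : ℝ × F → F) := contDiff_snd.contMDiff
  have hman : IsManifold 𝓘(ℝ, F) ∞ Q := by
    refine isManifold_of_contDiffOn _ _ _ ?_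
    rintro _ _ ⟨q, rfl⟩ ⟨q', rfl⟩
    rw [← contMDiffOn_iff_contDiffOn]
    have h1 := (contMDiffOn_section_comp_sliceChart_symm h (κ (s q))).mono
      (t := ((sliceChart h (κ (s q))).symm ≫ₕ sliceChart h (κ (s q'))).source) fun w hw ↦ hw.1
    have h2 := hsnd.comp_contMDiffOn ((κ (s q')).smooth.comp h1 fun w hw ↦ hw.2)
    refine h2.mono fun w hw ↦ hw.1
  have hchart : ∀ q : Q, chartAt F q = sliceChart h (κ (s q)) := fun _ ↦ rfl
  refine ⟨_cs, hman, ?_, ?_⟩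
  · intro q
    have h1 : ContMDiffOn 𝓘(ℝ, F) 𝓘(ℝ, F) ∞ (chartAt F q) (chartAt F q).source :=
      contMDiffOn_chart
    have h2 := contMDiffOn_section_comp_sliceChart_symm h (κ (s q))
    have h3 := (h2.comp h1 (fun x hx ↦ (chartAt F q).map_source hx)).contMDiffAt
      ((chartAt F q).open_source.mem_nhds (mem_chart_source F q))
    refine h3.congr_of_eventuallyEq ?_
    filter_upwards [(chartAt F q).open_source.mem_nhds (mem_chart_source F q)] with x hx
    exact congrArg s ((chartAt F q).left_inv hx).symm
  · intro p
    have h1 : ContMDiffOn 𝓘(ℝ, F) 𝓘(ℝ, F) ∞ (chartAt F (pr p)).symm (chartAt F (pr p)).target :=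
      contMDiffOn_chart_symm
    have h2 : ContMDiffOn 𝓘(ℝ, E) 𝓘(ℝ, F) ∞
        (fun x ↦ chartAt F (pr p) (pr x)) (pr ⁻¹' (chartAt F (pr p)).source) :=
      hsnd.comp_contMDiffOn ((κ (s (pr p))).smooth.comp hr.contMDiffOn fun x hx ↦ hx)
    have hopen : pr ⁻¹' (chartAt F (pr p)).source ∈ 𝓝 p :=
      ((chartAt F (pr p)).open_source.preimage h.continuous_proj).mem_nhds
        (mem_chart_source F (pr p))
    have h3 := (h1.comp h2 (fun x hx ↦ (chartAt F (pr p)).map_source hx)).contMDiffAt hopen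
    refine h3.congr_of_eventuallyEq ?_
    filter_upwards [hopen] with x hx
    exact ((chartAt F (pr p)).left_inv hx).symm

end Slice

/-! ### Principal `ℝ`-bundles -/

section Principal

open ProjTractor

variable {d m : ℕ} {P : Type*} [TopologicalSpace P] [ChartedSpace (Model d) P]

/-- A map out of the base of a principal bundle is smooth if its pull-back to the total space is,
because the projection has smooth local sections. -/
theorem IsPrincipalRealBundle.contMDiff_of_comp_proj {B B' : Type*} [TopologicalSpace B]
    [ChartedSpace (Model m) B] [TopologicalSpace B'] [ChartedSpace (Model m) B']
    {φ : ℝ → P → P} {pr : P → B} (h : IsPrincipalRealBundle (d := d) (m := m) φ pr)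
    {i : B → B'} (hi : ContMDiff 𝓘(ℝ, Model d) 𝓘(ℝ, Model m) ∞ (i ∘ pr)) :
    ContMDiff 𝓘(ℝ, Model m) 𝓘(ℝ, Model m) ∞ i := by
  intro b
  obtain ⟨U, Ψ, hU, hb, -, ht, -, hsymm, hfst, -⟩ := h.local_triv b
  have h1 : ContMDiff 𝓘(ℝ, Model m) (𝓘(ℝ, Model m).prod 𝓘(ℝ, ℝ)) ∞ (fun x : B ↦ (x, (0 : ℝ))) :=
    contMDiff_id.prodMk contMDiff_const
  have hmem : ∀ x ∈ U, (x, (0 : ℝ)) ∈ Ψ.target := fun x hx ↦ by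
    rw [ht]
    exact ⟨hx, trivial⟩
  have h2 := hi.comp_contMDiffOn (hsymm.comp h1.contMDiffOn (s := U) hmem)
  refine (h2.contMDiffAt (hU.mem_nhds hb)).congr_of_eventuallyEq ?_
  filter_upwards [hU.mem_nhds hb] with x hx
  have h3 := hfst _ (Ψ.map_target (hmem x hx))
  rw [Ψ.right_inv (hmem x hx)] at h3
  exact congrArg i h3

/-- A diffeomorphism pulls back compatible charts to compatible charts. -/
theorem transOpenPartialHomeomorph_mem_maximalAtlas {F : Type*} [NormedAddCommGroup F]
    [NormedSpace ℝ F] {B B' : Type*} [TopologicalSpace B] [TopologicalSpace B'] [ChartedSpace F B]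
    [ChartedSpace F B'] [IsManifold 𝓘(ℝ, F) ∞ B] [IsManifold 𝓘(ℝ, F) ∞ B'] (i : B' ≃ₜ B)
    (hi : ContMDiff 𝓘(ℝ, F) 𝓘(ℝ, F) ∞ i) (hi' : ContMDiff 𝓘(ℝ, F) 𝓘(ℝ, F) ∞ i.symm)
    {e : OpenPartialHomeomorph B F} (he : e ∈ IsManifold.maximalAtlas 𝓘(ℝ, F) ∞ B) :
    i.transOpenPartialHomeomorph e ∈ IsManifold.maximalAtlas 𝓘(ℝ, F) ∞ B' := by
  rw [IsManifold.mem_maximalAtlas_iff_contMDiffOn] at he ⊢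
  exact ⟨he.1.comp hi.contMDiffOn fun x hx ↦ hx, hi'.comp_contMDiffOn he.2⟩

/-- The smooth structure on the base of a principal bundle is determined by the projection. -/
theorem maximalAtlas_eq_of_isPrincipalRealBundle {B : Type*} [TopologicalSpace B]
    {cs cs' : ChartedSpace (Model m) B}
    (hm : @IsManifold ℝ _ _ _ _ _ _ 𝓘(ℝ, Model m) ∞ B _ cs)
    (hm' : @IsManifold ℝ _ _ _ _ _ _ 𝓘(ℝ, Model m) ∞ B _ cs') {pr : P → B} {φ ψ : ℝ → P → P}
    (h : @IsPrincipalRealBundle d m P _ _ B _ cs φ pr)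
    (h' : @IsPrincipalRealBundle d m P _ _ B _ cs' ψ pr) :
    @IsManifold.maximalAtlas ℝ _ _ _ _ _ _ 𝓘(ℝ, Model m) ∞ B _ cs' =
      @IsManifold.maximalAtlas ℝ _ _ _ _ _ _ 𝓘(ℝ, Model m) ∞ B _ cs := by
  have h1 := @IsPrincipalRealBundle.contMDiff_of_comp_proj d m P _ _ B B _ cs _ cs' φ pr h id
    (@IsPrincipalRealBundle.proj_smooth d m P _ _ B _ cs' ψ pr h')
  have h2 := @IsPrincipalRealBundle.contMDiff_of_comp_proj d m P _ _ B B _ cs' _ cs ψ pr h' id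
    (@IsPrincipalRealBundle.proj_smooth d m P _ _ B _ cs φ pr h)
  refine subset_antisymm (fun e he ↦ ?_) (fun e he ↦ ?_)
  · exact @transOpenPartialHomeomorph_mem_maximalAtlas (Model m) _ _ B B _ _ cs' cs hm' hm
      (Homeomorph.refl B) h1 h2 e he
  · exact @transOpenPartialHomeomorph_mem_maximalAtlas (Model m) _ _ B B _ _ cs cs' hm hm'
      (Homeomorph.refl B) h2 h1 e he

end Principal

/-! ### Inverse matrices depending on parameters -/

section MatrixInverse

open Matrix

variable {ι : Type*} [Fintype ι] [DecidableEq ι]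

theorem contDiff_det_of {X : Type*} [NormedAddCommGroup X] [NormedSpace ℝ X]
    {A : X → Matrix ι ι ℝ} (hA : ∀ i j, ContDiff ℝ ∞ fun x ↦ A x i j) :
    ContDiff ℝ ∞ fun x ↦ (A x).det := by
  simp only [det_apply]
  exact ContDiff.sum fun τ _ ↦ (contDiff_prod fun i _ ↦ hA _ _).const_smul _

/-- The entries of the inverse matrix are smooth functions of the entries, by Cramer's rule. -/
theorem contDiffAt_inv_entry {A : ι → ι → ℝ} (hA : (of A).det ≠ 0) (i j : ι) :
    ContDiffAt ℝ ∞ (fun B : ι → ι → ℝ ↦ (of B)⁻¹ i j) A := by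
  have hentry : ∀ k l, ContDiff ℝ ∞ fun B : ι → ι → ℝ ↦ (of B) k l := fun k l ↦
    contDiff_apply_apply ℝ ℝ k l
  have hdet := contDiff_det_of hentry
  have hadj : ContDiff ℝ ∞ fun B : ι → ι → ℝ ↦ (of B).adjugate i j := by
    simp only [adjugate_apply]
    refine contDiff_det_of fun k l ↦ ?_
    by_cases hk : k = j
    · simp only [hk, updateRow_self]
      exact contDiff_const
    · simp only [updateRow_ne hk]
      exact hentry k l
  have hinv : (fun B : ι → ι → ℝ ↦ (of B)⁻¹ i j) =
      fun B ↦ (of B).det⁻¹ * (of B).adjugate i j := by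
    funext B
    rw [inv_def, Matrix.smul_apply, smul_eq_mul, Ring.inverse_eq_inv']
  rw [hinv]
  exact (hdet.contDiffAt.inv hA).mul hadj.contDiffAt

/-- If a bilinear form on covectors is parallel for the connection matrix `A`, then so is its
inverse. -/
theorem hasDerivAt_inverse_of_parallel {h p : ℝ → Matrix ι ι ℝ} {A : Matrix ι ι ℝ} {t : ℝ}
    (hp : ∀ s, p s * h s = 1)
    (hh : ∀ i j, HasDerivAt (fun s ↦ h s i j) (-(A * h t + h t * Aᵀ) i j) t)
    (hpd : ∀ i j, DifferentiableAt ℝ (fun s ↦ p s i j) t) (i j : ι) :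
    HasDerivAt (fun s ↦ p s i j) ((p t * A + Aᵀ * p t) i j) t := by
  let p' : Matrix ι ι ℝ := of fun i j ↦ deriv (fun s ↦ p s i j) t
  have hhp : h t * p t = 1 := mul_eq_one_comm.mp (hp t)
  have h1 : p' * h t = p t * (A * h t + h t * Aᵀ) := by
    ext k l
    have hd : HasDerivAt (fun s ↦ (p s * h s) k l)
        ((p' * h t) k l + (p t * -(A * h t + h t * Aᵀ)) k l) t := by
      simp only [mul_apply, ← Finset.sum_add_distrib]
      exact HasDerivAt.fun_sum fun m _ ↦ (hpd k m).hasDerivAt.mul (hh m l)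
    simp only [hp] at hd
    have h2 := hd.unique (hasDerivAt_const t ((1 : Matrix ι ι ℝ) k l))
    rw [Matrix.mul_neg, Matrix.neg_apply] at h2
    linarith
  have h2 : p' = p t * A + Aᵀ * p t := by
    calc p' = p' * h t * p t := by rw [Matrix.mul_assoc, hhp, Matrix.mul_one]
      _ = p t * A * (h t * p t) + (p t * h t) * Aᵀ * p t := by
          rw [h1]
          simp only [Matrix.mul_add, Matrix.add_mul, Matrix.mul_assoc]
      _ = p t * A + Aᵀ * p t := by rw [hhp, hp, Matrix.mul_one, Matrix.one_mul]
  rw [← h2]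
  exact (hpd i j).hasDerivAt

end MatrixInverse

/-! ### The tractor metric in a frame -/

/-- The chain rule along a curve. -/
theorem hasDerivAt_comp_curve {E : Type*} [NormedAddCommGroup E] [NormedSpace ℝ E] {M : Type*}
    [TopologicalSpace M] [ChartedSpace E M] {V : Type*} [NormedAddCommGroup V] [NormedSpace ℝ V]
    {f : M → V} {γ : ℝ → M} {t : ℝ} {v : TangentSpace 𝓘(ℝ, E) (γ t)}
    (hf : MDifferentiableAt 𝓘(ℝ, E) 𝓘(ℝ, V) f (γ t))
    (hγ : HasMFDerivAt 𝓘(ℝ, ℝ) 𝓘(ℝ, E) γ t ((1 : ℝ →L[ℝ] ℝ).smulRight v)) :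
    HasDerivAt (f ∘ γ) (mvfderiv 𝓘(ℝ, E) f (γ t) v) t := by
  let f' : E →L[ℝ] V := mvfderiv 𝓘(ℝ, E) f (γ t)
  have h1 : HasFDerivAt (f ∘ γ)
      (f'.comp ((1 : ℝ →L[ℝ] ℝ).smulRight (show E from v))) t :=
    (hf.hasMFDerivAt.comp t hγ).hasFDerivAt
  refine h1.hasDerivAt.congr_deriv ?_
  change f' ((1 : ℝ) • (show E from v)) = _
  rw [one_smul]
  rfl

noncomputable section

namespace ProjTractor

section Tractor

variable {n : ℕ} {M : Type*} [TopologicalSpace M] [ChartedSpace (Model (n + 1)) M]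
  [IsManifold 𝓘(ℝ, Model (n + 1)) ∞ M] {c : ProjectiveStructure n M}

/-- A tractor is determined by its components in one scale and one frame, since all the scales in
the class differ by a `1`-form. -/
theorem tractorComp_injective (cov : c.conns) {x : M} (e : Frame (n := n) x) :
    Function.Injective (tractorComp cov e) := by
  rw [injective_iff_map_eq_zero]
  intro T hT
  have hT' : T.1 cov e = 0 := hT
  refine Subtype.ext (funext fun cov' ↦ funext fun e' ↦ ?_)
  obtain ⟨A, rfl⟩ := HolonomyReduction.exists_frame_change e e'
  obtain ⟨Υ, -, hΥ⟩ := (c.mem_iff cov.1 cov.2 cov'.1 (c.smooth _ cov'.2)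
    (c.torsion_free _ cov'.2)).mp cov'.2
  have h1 : T.1 cov (A.trans e) = 0 := by
    rw [T.2.1 cov e A, hT']
    ext <;> simp
  rw [T.2.2 cov cov' (A.trans e) (Υ x) (hΥ x), h1]
  ext <;> simp

namespace HolonomyReduction

variable (D : HolonomyReduction c)

/-- The components of tractors in a scale and a frame, as a linear isomorphism. -/
def tractorEquiv (cov : c.conns) {x : M} (e : Frame (n := n) x) :
    c.Tractor x ≃ₗ[ℝ] Model (n + 1) × ℝ :=
  have : FiniteDimensional ℝ (c.Tractor x) :=
    FiniteDimensional.of_injective _ (tractorComp_injective cov e)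
  LinearEquiv.ofInjectiveOfFinrankEq (tractorComp cov e) (tractorComp_injective cov e) (by
    -- the signature of `H` gives the rank of the tractor bundle
    obtain ⟨b, -⟩ := D.H_signature x
    rw [← Subspace.dual_finrank_eq, finrank_eq_card_basis b]
    simp [add_comm, add_left_comm])

theorem Φ_symm (x : M) (S T : c.Tractor x) : D.Φ x S T = D.Φ x T S := by
  rw [← D.Φ_inverse x T (D.Φ x S), D.H_symm, D.Φ_inverse]

variable (n) in
/-- A basis of the space of components of tractors. -/
def compBasis : Basis (Fin (finrank ℝ (Model (n + 1) × ℝ))) ℝ (Model (n + 1) × ℝ) :=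
  finBasis ℝ (Model (n + 1) × ℝ)

theorem tensorComp_sum_left (cov : c.conns) (x₀ y : M) {ι : Type*} [Fintype ι] (a : ι → ℝ)
    (α : ι → Dual ℝ (Model (n + 1) × ℝ)) (β : Dual ℝ (Model (n + 1) × ℝ)) :
    tensorComp D.H cov x₀ (∑ k, a k • α k) β y = ∑ k, a k * tensorComp D.H cov x₀ (α k) β y := by
  have h : (∑ k, a k • α k) ∘ₗ tractorComp cov (coordFrame x₀ y) =
      (tractorComp cov (coordFrame x₀ y)).dualMap (∑ k, a k • α k) := rfl
  rw [tensorComp, h]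
  simp only [map_sum, map_smul, LinearMap.sum_apply, LinearMap.smul_apply, smul_eq_mul]
  rfl

theorem tensorComp_sum_right (cov : c.conns) (x₀ y : M) {ι : Type*} [Fintype ι] (a : ι → ℝ)
    (α : Dual ℝ (Model (n + 1) × ℝ)) (β : ι → Dual ℝ (Model (n + 1) × ℝ)) :
    tensorComp D.H cov x₀ α (∑ k, a k • β k) y = ∑ k, a k * tensorComp D.H cov x₀ α (β k) y := by
  have h : (∑ k, a k • β k) ∘ₗ tractorComp cov (coordFrame x₀ y) =
      (tractorComp cov (coordFrame x₀ y)).dualMap (∑ k, a k • β k) := rfl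
  rw [tensorComp, h]
  simp only [map_sum, map_smul, smul_eq_mul]
  rfl

open Matrix

/-- The matrix of `H` in a scale and the coordinate frame around `x₀`. -/
def matrixH (cov : c.conns) (x₀ y : M) : Matrix (Fin (finrank ℝ (Model (n + 1) × ℝ)))
    (Fin (finrank ℝ (Model (n + 1) × ℝ))) ℝ :=
  of fun i j ↦ tensorComp D.H cov x₀ ((compBasis n).coord i) ((compBasis n).coord j) y

/-- The matrix of `Φ` in a scale and the coordinate frame around `x₀`. -/
def matrixΦ (cov : c.conns) (x₀ y : M) : Matrix (Fin (finrank ℝ (Model (n + 1) × ℝ)))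
    (Fin (finrank ℝ (Model (n + 1) × ℝ))) ℝ :=
  of fun i j ↦ D.Φ y ((D.tractorEquiv cov (coordFrame x₀ y)).symm (compBasis n i))
    ((D.tractorEquiv cov (coordFrame x₀ y)).symm (compBasis n j))

theorem matrixΦ_mul_matrixH (cov : c.conns) (x₀ y : M) :
    D.matrixΦ cov x₀ y * D.matrixH cov x₀ y = 1 := by
  ext i j
  let L := D.tractorEquiv cov (coordFrame x₀ y)
  have hexp : D.Φ y (L.symm (compBasis n i)) = ∑ k, D.matrixΦ cov x₀ y i k •
      ((compBasis n).coord k ∘ₗ tractorComp cov (coordFrame x₀ y)) := by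
    refine ((compBasis n).map L.symm).ext fun k ↦ ?_
    have h1 : ∀ l, tractorComp cov (coordFrame x₀ y) (L.symm l) = l := L.apply_symm_apply
    simp [h1, matrixΦ, L, Finsupp.single_apply]
  have h2 := D.Φ_inverse y (L.symm (compBasis n i))
    ((compBasis n).coord j ∘ₗ tractorComp cov (coordFrame x₀ y))
  rw [hexp] at h2
  have h3 : tractorComp cov (coordFrame x₀ y) (L.symm (compBasis n i)) = compBasis n i :=
    L.apply_symm_apply _
  simp only [map_sum, map_smul, LinearMap.sum_apply, LinearMap.smul_apply, smul_eq_mul,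
    LinearMap.comp_apply, h3, Basis.coord_apply, Basis.repr_self] at h2
  rw [mul_apply, one_apply]
  rw [Finsupp.single_apply] at h2
  exact h2

theorem Φ_apply (cov : c.conns) (x₀ y : M) (S T : c.Tractor y) :
    D.Φ y S T = (compBasis n).repr (tractorComp cov (coordFrame x₀ y) S) ⬝ᵥ
      D.matrixΦ cov x₀ y *ᵥ (compBasis n).repr (tractorComp cov (coordFrame x₀ y) T) := by
  let L := D.tractorEquiv cov (coordFrame x₀ y)
  have hexp : ∀ S : c.Tractor y,
      S = ∑ k, (compBasis n).repr (tractorComp cov (coordFrame x₀ y) S) k •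
        L.symm (compBasis n k) := by
    intro S
    apply L.injective
    rw [map_sum]
    simp only [map_smul, LinearEquiv.apply_symm_apply]
    exact ((compBasis n).sum_repr (L S)).symm
  conv_lhs => rw [hexp S, hexp T]
  simp only [map_sum, map_smul, LinearMap.sum_apply, LinearMap.smul_apply, smul_eq_mul,
    dotProduct, mulVec, Finset.mul_sum, matrixΦ, of_apply]
  rw [Finset.sum_comm]
  refine Finset.sum_congr rfl fun i _ ↦ Finset.sum_congr rfl fun j _ ↦ ?_
  change _ = _ * (D.Φ y (L.symm _) (L.symm _) * _)
  ring

theorem contMDiffOn_matrixΦ (cov : c.conns) (x₀ : M)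
    (i j : Fin (finrank ℝ (Model (n + 1) × ℝ))) :
    ContMDiffOn 𝓘(ℝ, Model (n + 1)) 𝓘(ℝ, ℝ) ∞ (fun y ↦ D.matrixΦ cov x₀ y i j)
      (chartAt (Model (n + 1)) x₀).source := by
  have h1 : ContMDiffOn 𝓘(ℝ, Model (n + 1)) 𝓘(ℝ, Fin (finrank ℝ (Model (n + 1) × ℝ)) →
      Fin (finrank ℝ (Model (n + 1) × ℝ)) → ℝ) ∞
      (fun y k l ↦ D.matrixH cov x₀ y k l) (chartAt (Model (n + 1)) x₀).source := by
    rw [contMDiffOn_pi_space]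
    intro k
    rw [contMDiffOn_pi_space]
    exact fun l ↦ D.H_smooth cov x₀ _ _
  intro y hy
  have hdet : (of fun k l ↦ D.matrixH cov x₀ y k l).det ≠ 0 := by
    intro h0
    have h2 := congrArg Matrix.det (D.matrixΦ_mul_matrixH cov x₀ y)
    rw [det_mul, det_one] at h2
    exact one_ne_zero (h2.symm.trans (mul_eq_zero_of_right _ h0))
  have h2 := (contDiffAt_inv_entry hdet i j).contMDiffAt.comp_contMDiffWithinAt y (h1 y hy)
  refine h2.congr_of_eventuallyEq (Eventually.of_forall fun z ↦ ?_) ?_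
  all_goals exact congrFun (congrFun (inv_eq_left_inv (D.matrixΦ_mul_matrixH cov x₀ _)).symm i) j

/-- The pairing of tractor fields with smooth components is smooth. -/
theorem contMDiffOn_pairing {cov : c.conns} {x₀ : M} {S T : ∀ x : M, c.Tractor x}
    (hS : ContMDiffOn 𝓘(ℝ, Model (n + 1)) 𝓘(ℝ, Model (n + 1) × ℝ) ∞ (fieldComp S cov x₀)
      (chartAt (Model (n + 1)) x₀).source)
    (hT : ContMDiffOn 𝓘(ℝ, Model (n + 1)) 𝓘(ℝ, Model (n + 1) × ℝ) ∞ (fieldComp T cov x₀)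
      (chartAt (Model (n + 1)) x₀).source) :
    ContMDiffOn 𝓘(ℝ, Model (n + 1)) 𝓘(ℝ, ℝ) ∞ (fun y ↦ D.Φ y (S y) (T y))
      (chartAt (Model (n + 1)) x₀).source := by
  have hcoord : ∀ k, ContMDiff 𝓘(ℝ, Model (n + 1) × ℝ) 𝓘(ℝ, ℝ) ∞
      (fun u ↦ (compBasis n).repr u k) := fun k ↦
    (LinearMap.toContinuousLinearMap ((compBasis n).coord k)).contMDiff
  simp only [D.Φ_apply cov x₀, dotProduct, mulVec]
  refine contMDiffOn_finsetSum fun i _ ↦ ((hcoord i).comp_contMDiffOn hS).mul ?_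
  exact contMDiffOn_finsetSum fun j _ ↦
    (D.contMDiffOn_matrixΦ cov x₀ i j).mul ((hcoord j).comp_contMDiffOn hT)

/-- As `Φ` is parallel, the derivative of `Φ(S, T)` along a curve is `Φ(∇S, T) + Φ(S, ∇T)`. -/
theorem hasDerivAt_pairing (cov : c.conns) {γ : ℝ → M} {t : ℝ}
    {v : TangentSpace 𝓘(ℝ, Model (n + 1)) (γ t)}
    (hγ : HasMFDerivAt 𝓘(ℝ, ℝ) 𝓘(ℝ, Model (n + 1)) γ t ((1 : ℝ →L[ℝ] ℝ).smulRight v))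
    {S T : ∀ x : M, c.Tractor x} {S' T' : Model (n + 1) × ℝ}
    (hS : HasDerivAt (fun s ↦ fieldComp S cov (γ t) (γ s)) S' t)
    (hT : HasDerivAt (fun s ↦ fieldComp T cov (γ t) (γ s)) T' t) :
    HasDerivAt (fun s ↦ D.Φ (γ s) (S (γ s)) (T (γ s)))
      (D.Φ (γ t) ((D.tractorEquiv cov (coordFrame (γ t) (γ t))).symm
          (S' + tractorConnForm cov.1 (γ t) v (fieldComp S cov (γ t) (γ t)))) (T (γ t)) +
        D.Φ (γ t) (S (γ t)) ((D.tractorEquiv cov (coordFrame (γ t) (γ t))).symm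
          (T' + tractorConnForm cov.1 (γ t) v (fieldComp T cov (γ t) (γ t))))) t := by
  let b := compBasis n
  let A := LinearMap.toMatrix b b (tractorConnForm cov.1 (γ t) v)
  have hsource : (chartAt (Model (n + 1)) (γ t)).source ∈ 𝓝 (γ t) :=
    chart_source_mem_nhds (Model (n + 1)) (γ t)
  have hA : ∀ i, b.coord i ∘ₗ tractorConnForm cov.1 (γ t) v = ∑ k, A i k • b.coord k := by
    intro i
    refine b.ext fun k ↦ ?_
    simp [A, LinearMap.toMatrix_apply, Finsupp.single_apply]
  have hh : ∀ i j, HasDerivAt (fun s ↦ D.matrixH cov (γ t) (γ s) i j)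
      (-(A * D.matrixH cov (γ t) (γ t) + D.matrixH cov (γ t) (γ t) * Aᵀ) i j) t := by
    intro i j
    have h1 := hasDerivAt_comp_curve (((D.H_smooth cov (γ t) (b.coord i) (b.coord j)).contMDiffAt
      hsource).mdifferentiableAt (by simp)) hγ
    refine h1.congr_deriv ?_
    have h2 := D.H_parallel cov (γ t) v (b.coord i) (b.coord j)
    rw [hA, hA] at h2
    have h3 : tensorComp D.H cov (γ t) (∑ k, A i k • b.coord k) (b.coord j) (γ t) =
        (A * D.matrixH cov (γ t) (γ t)) i j := by
      rw [tensorComp_sum_left, mul_apply]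
      rfl
    have h4 : tensorComp D.H cov (γ t) (b.coord i) (∑ k, A j k • b.coord k) (γ t) =
        (D.matrixH cov (γ t) (γ t) * Aᵀ) i j := by
      rw [tensorComp_sum_right, mul_apply]
      exact Finset.sum_congr rfl fun k _ ↦ mul_comm _ _
    rw [h3, h4] at h2
    rw [Matrix.add_apply]
    linarith
  have hpd : ∀ i j, DifferentiableAt ℝ (fun s ↦ D.matrixΦ cov (γ t) (γ s) i j) t := fun i j ↦
    (hasDerivAt_comp_curve (((D.contMDiffOn_matrixΦ cov (γ t) i j).contMDiffAt
      hsource).mdifferentiableAt (by simp)) hγ).differentiableAt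
  have hp := hasDerivAt_inverse_of_parallel (fun s ↦ D.matrixΦ_mul_matrixH cov (γ t) (γ s)) hh hpd
  have hcoord : ∀ (f : ℝ → Model (n + 1) × ℝ) f' k, HasDerivAt f f' t →
      HasDerivAt (fun s ↦ b.repr (f s) k) (b.repr f' k) t := fun f f' k hf ↦
    (LinearMap.toContinuousLinearMap (b.coord k)).hasFDerivAt.comp_hasDerivAt t hf
  have hprod : HasDerivAt (fun s ↦ D.Φ (γ s) (S (γ s)) (T (γ s)))
      (b.repr S' ⬝ᵥ D.matrixΦ cov (γ t) (γ t) *ᵥ b.repr (fieldComp T cov (γ t) (γ t)) +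
        b.repr (fieldComp S cov (γ t) (γ t)) ⬝ᵥ
          (D.matrixΦ cov (γ t) (γ t) * A + Aᵀ * D.matrixΦ cov (γ t) (γ t)) *ᵥ
          b.repr (fieldComp T cov (γ t) (γ t)) +
        b.repr (fieldComp S cov (γ t) (γ t)) ⬝ᵥ D.matrixΦ cov (γ t) (γ t) *ᵥ b.repr T') t := by
    simp only [D.Φ_apply cov (γ t), dotProduct, mulVec, ← Finset.sum_add_distrib, Finset.mul_sum]
    refine HasDerivAt.fun_sum fun i _ ↦ HasDerivAt.fun_sum fun j _ ↦ ?_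
    refine ((hcoord _ _ i hS).mul ((hp i j).mul (hcoord _ _ j hT))).congr_deriv ?_
    simp only [Pi.mul_apply]
    ring
  refine hprod.congr_deriv ?_
  have hAu : ∀ u, b.repr (tractorConnForm cov.1 (γ t) v u) = A *ᵥ b.repr u := fun u ↦
    (LinearMap.toMatrix_mulVec_repr b b _ u).symm
  have hL : ∀ u, tractorComp cov (coordFrame (γ t) (γ t))
      ((D.tractorEquiv cov (coordFrame (γ t) (γ t))).symm u) = u :=
    (D.tractorEquiv cov (coordFrame (γ t) (γ t))).apply_symm_apply
  rw [D.Φ_apply cov (γ t), D.Φ_apply cov (γ t), hL, hL]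
  change _ = b.repr _ ⬝ᵥ _ *ᵥ b.repr (fieldComp T cov (γ t) (γ t)) +
    b.repr (fieldComp S cov (γ t) (γ t)) ⬝ᵥ _ *ᵥ b.repr _
  simp only [map_add, Finsupp.coe_add, hAu, add_dotProduct, mulVec_add, dotProduct_add, add_mulVec,
    ← mulVec_mulVec]
  rw [dotProduct_mulVec _ Aᵀ, vecMul_transpose]
  ring

end HolonomyReduction

end Tractor

end ProjTractor

end

/-! ### The vector field `N` and the function `l` -/

noncomputable section

namespace ProjTractor

namespace HolonomyReduction

variable {n : ℕ} {M : Type*} [TopologicalSpace M] [ChartedSpace (Model (n + 1)) M]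
  [IsManifold 𝓘(ℝ, Model (n + 1)) ∞ M] {c : ProjectiveStructure n M} (D : HolonomyReduction c)

variable (c) in
/-- The scale in which `nvec` is computed. -/
def baseScale : c.conns := ⟨c.nonempty.some, c.nonempty.some_mem⟩

/-- The canonical tractor in the coordinate frame around `x₀`, as a tractor field. -/
def canonicalField (x₀ y : M) : c.Tractor y := canonicalTractor c (coordFrame x₀ y)

theorem fieldComp_canonicalField (cov : c.conns) (x₀ y : M) :
    fieldComp (canonicalField (c := c) x₀) cov x₀ y = (0, 1) := by
  have h : (coordFrame x₀ y).trans (coordFrame x₀ y).symm =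
      ContinuousLinearEquiv.refl ℝ (Model (n + 1)) :=
    ContinuousLinearEquiv.ext (funext fun v ↦ by simp)
  change ((0 : Model (n + 1)), absDet ((coordFrame x₀ y).trans (coordFrame x₀ y).symm) ^
    (1 / (n + 2 : ℝ))) = (0, 1)
  have h1 : absDet (ContinuousLinearEquiv.refl ℝ (Model (n + 1))) = 1 := by
    have h2 : ((ContinuousLinearEquiv.refl ℝ (Model (n + 1)) :
        Model (n + 1) ≃L[ℝ] Model (n + 1)) : Model (n + 1) →ₗ[ℝ] Model (n + 1)) =
        LinearMap.id := rfl
    rw [absDet, h2, LinearMap.det_id, abs_one]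
  rw [h, h1, Real.one_rpow]

theorem contMDiffOn_fieldComp_canonicalField (cov : c.conns) (x₀ : M) :
    ContMDiffOn 𝓘(ℝ, Model (n + 1)) 𝓘(ℝ, Model (n + 1) × ℝ) ∞
      (fieldComp (canonicalField (c := c) x₀) cov x₀) (chartAt (Model (n + 1)) x₀).source :=
  contMDiffOn_const.congr fun y _ ↦ fieldComp_canonicalField cov x₀ y

theorem contMDiffOn_sigma (x₀ : M) :
    ContMDiffOn 𝓘(ℝ, Model (n + 1)) 𝓘(ℝ, ℝ) ∞ (fun y ↦ (D.sigma y).1 (coordFrame x₀ y))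
      (chartAt (Model (n + 1)) x₀).source :=
  D.contMDiffOn_pairing (D.I_smooth (baseScale c) x₀)
    (contMDiffOn_fieldComp_canonicalField (baseScale c) x₀)

theorem contMDiffOn_lam (x₀ : M) :
    ContMDiffOn 𝓘(ℝ, Model (n + 1)) 𝓘(ℝ, ℝ) ∞ (fun y ↦ (D.lam y).1 (coordFrame x₀ y))
      (chartAt (Model (n + 1)) x₀).source :=
  D.contMDiffOn_pairing (contMDiffOn_fieldComp_canonicalField (baseScale c) x₀)
    (contMDiffOn_fieldComp_canonicalField (baseScale c) x₀)

theorem sigma_apply_eq_zero_iff {x : M} (e : Frame (n := n) x) :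
    (D.sigma x).1 e = 0 ↔ D.sigma x = 0 := by
  refine ⟨fun h ↦ Subtype.ext (funext fun e' ↦ ?_), fun h ↦ by rw [h]; rfl⟩
  obtain ⟨A, rfl⟩ := exists_frame_change e e'
  rw [(D.sigma x).2 e A, h, mul_zero]
  rfl

theorem mem_openOrbit_iff {x : M} (e : Frame (n := n) x) :
    x ∈ D.openOrbit ↔ (D.sigma x).1 e ≠ 0 :=
  (D.sigma_apply_eq_zero_iff e).not.symm

theorem isOpen_openOrbit : IsOpen D.openOrbit := by
  rw [isOpen_iff_mem_nhds]
  intro x hx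
  have hsource : (chartAt (Model (n + 1)) x).source ∈ 𝓝 x :=
    chart_source_mem_nhds (Model (n + 1)) x
  have hcont := ((D.contMDiffOn_sigma x).contMDiffAt hsource).continuousAt
  filter_upwards [hcont.eventually_ne ((D.mem_openOrbit_iff (coordFrame x x)).mp hx)] with y hy
  exact (D.mem_openOrbit_iff _).mpr hy

theorem contMDiffAt_l {x : M} (hx : x ∈ D.openOrbit) :
    ContMDiffAt 𝓘(ℝ, Model (n + 1)) 𝓘(ℝ, ℝ) ∞ D.l x := by
  have hsource : (chartAt (Model (n + 1)) x).source ∈ 𝓝 x :=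
    chart_source_mem_nhds (Model (n + 1)) x
  have h1 := (D.contMDiffOn_sigma x).contMDiffAt hsource
  have h2 := (D.contMDiffOn_lam x).contMDiffAt hsource
  have h3 := (h1.inv₀ ((D.mem_openOrbit_iff (coordFrame x x)).mp hx)).pow 2
  exact (h3.mul h2).congr_of_eventuallyEq (Eventually.of_forall fun y ↦ D.l_eq _)

theorem N_eq_zero {x : M} (hx : x ∉ D.openOrbit) : D.N x = 0 := by
  have h : (D.sigma x).1 (coordFrame x x) = 0 :=
    not_not.mp fun h ↦ hx ((D.mem_openOrbit_iff _).mpr h)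
  rw [N, h, zero_smul]

/-- The components of `N` in the coordinate frame around `x₀`. -/
theorem N_eq_coordFrame (x₀ y : M) : D.N y = coordFrame x₀ y
    ((D.sigma y).1 (coordFrame x₀ y) • (fieldComp D.I (baseScale c) x₀ y).1) := by
  rw [D.N_eq (coordFrame x₀ y), map_smul]
  rfl

theorem contMDiff_N : ContMDiff 𝓘(ℝ, Model (n + 1)) 𝓘(ℝ, Model (n + 1)).tangent ∞
    (fun x ↦ (⟨x, D.N x⟩ : TangentBundle 𝓘(ℝ, Model (n + 1)) M)) := by
  intro x₀
  let e := trivializationAt (Model (n + 1))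
    (TangentSpace 𝓘(ℝ, Model (n + 1)) : M → Type _) x₀
  have hsource : (chartAt (Model (n + 1)) x₀).source ∈ 𝓝 x₀ :=
    chart_source_mem_nhds (Model (n + 1)) x₀
  rw [e.contMDiffAt_section_iff (mem_of_mem_nhds hsource)]
  have h1 := (D.contMDiffOn_sigma x₀).contMDiffAt hsource
  have h2 := (D.I_smooth (baseScale c) x₀).contMDiffAt hsource
  have h3 : ContMDiff 𝓘(ℝ, Model (n + 1) × ℝ) 𝓘(ℝ, Model (n + 1)) ∞
      (Prod.fst : Model (n + 1) × ℝ → Model (n + 1)) := contDiff_fst.contMDiff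
  refine (h1.smul (h3.contMDiffAt.comp x₀ h2)).congr_of_eventuallyEq ?_
  filter_upwards [hsource] with y hy
  have hy' : y ∈ e.baseSet := hy
  rw [D.N_eq_coordFrame x₀ y]
  have hframe : coordFrame x₀ y = (e.continuousLinearEquivAt ℝ y hy').symm := dif_pos hy'
  have hcomp : ∀ w, (e ⟨y, coordFrame x₀ y w⟩).2 = w := fun w ↦ by
    rw [hframe]
    exact (e.continuousLinearEquivAt ℝ y hy').apply_symm_apply w
  exact hcomp _

/-- Along an integral curve of `N`, the function `l` has derivative `2`. Let `σ`, `λ` be the values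
of the densities in the coordinate frame, and `I = n + r X` the components of `I`. The velocity is
`σ n`, so that `∇X = σ n - τ X = σ I - (τ + σ r) X`, where `-τ` is the connection form on densities.
With `κ = τ + σ r` and `∇I = 0` this gives `σ' = -κ σ`, as `I` is null, and
`λ' = 2 σ² - 2 κ λ`. -/
theorem hasDerivAt_l {γ : ℝ → M} {t : ℝ} (ht : γ t ∈ D.openOrbit)
    (hγ : HasMFDerivAt 𝓘(ℝ, ℝ) 𝓘(ℝ, Model (n + 1)) γ t
      ((1 : ℝ →L[ℝ] ℝ).smulRight (D.N (γ t)))) :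
    HasDerivAt (fun s ↦ D.l (γ s)) 2 t := by
  let cov := baseScale c
  let e : Frame (n := n) (γ t) := coordFrame (γ t) (γ t)
  let L := D.tractorEquiv cov e
  let X := canonicalField (c := c) (γ t)
  let σ : ℝ → ℝ := fun s ↦ (D.sigma (γ s)).1 (coordFrame (γ t) (γ s))
  let lam : ℝ → ℝ := fun s ↦ (D.lam (γ s)).1 (coordFrame (γ t) (γ s))
  let τ : ℝ := LinearMap.trace ℝ _ (connForm cov.1 (γ t) (D.N (γ t))) / (n + 2)
  let u := fieldComp D.I cov (γ t) (γ t)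
  let κ : ℝ := τ + σ t * u.2
  have hσ0 : σ t ≠ 0 := (D.mem_openOrbit_iff _).mp ht
  have hsource : (chartAt (Model (n + 1)) (γ t)).source ∈ 𝓝 (γ t) :=
    chart_source_mem_nhds (Model (n + 1)) (γ t)
  -- `∇I = 0`
  have hI := hasDerivAt_comp_curve (((D.I_smooth cov (γ t)).contMDiffAt
    hsource).mdifferentiableAt (by simp)) hγ
  have hIp := D.I_parallel cov (γ t) (D.N (γ t))
  -- `∇X = σ I - κ X`
  have hX : HasDerivAt (fun s ↦ fieldComp X cov (γ t) (γ s)) 0 t := by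
    simp only [X, fieldComp_canonicalField]
    exact hasDerivAt_const t _
  have hu : L (D.I (γ t)) = u := rfl
  have hX0 : L (X (γ t)) = (0, 1) := fieldComp_canonicalField cov (γ t) (γ t)
  have hXp : L.symm (0 + tractorConnForm cov.1 (γ t) (D.N (γ t)) (fieldComp X cov (γ t) (γ t))) =
      σ t • D.I (γ t) - κ • X (γ t) := by
    rw [LinearEquiv.symm_apply_eq, map_sub, map_smul, map_smul, hu, hX0, zero_add,
      fieldComp_canonicalField]
    have hN : e.symm (D.N (γ t)) = σ t • u.1 := by
      rw [D.N_eq_coordFrame (γ t) (γ t)]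
      exact e.symm_apply_apply _
    refine Prod.ext ?_ ?_
    · change connForm cov.1 (γ t) (D.N (γ t)) 0 - τ • 0 + (1 : ℝ) • e.symm (D.N (γ t)) =
        σ t • u.1 - κ • (0 : Model (n + 1))
      rw [map_zero, hN]
      module
    · change -τ * 1 - schoutenForm cov.1 (γ t) (D.N (γ t)) 0 = σ t * u.2 - κ * 1
      rw [map_zero]
      simp only [κ]
      ring
  have hIX : D.Φ (γ t) (X (γ t)) (D.I (γ t)) = σ t := D.Φ_symm _ _ _
  have hIX' : D.Φ (γ t) (D.I (γ t)) (X (γ t)) = σ t := rfl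
  have hXX : D.Φ (γ t) (X (γ t)) (X (γ t)) = lam t := rfl
  have hσ : HasDerivAt σ (-(κ * σ t)) t := by
    refine (D.hasDerivAt_pairing cov hγ hI hX).congr_deriv ?_
    rw [hIp, hXp, map_zero, map_zero, LinearMap.zero_apply, map_sub, map_smul, map_smul,
      D.I_null, hIX']
    simp
  have hlam : HasDerivAt lam (2 * (σ t ^ 2 - κ * lam t)) t := by
    refine (D.hasDerivAt_pairing cov hγ hX hX).congr_deriv ?_
    rw [hXp, D.Φ_symm _ (σ t • D.I (γ t) - κ • X (γ t)), map_sub, map_smul, map_smul, hIX, hXX]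
    simp only [smul_eq_mul]
    ring
  have hl : (fun s ↦ D.l (γ s)) = fun s ↦ (σ s)⁻¹ ^ 2 * lam s := funext fun s ↦ D.l_eq _
  rw [hl]
  refine (((hσ.fun_inv hσ0).fun_pow 2).fun_mul hlam).congr_deriv ?_
  generalize σ t = a at hσ0 ⊢
  generalize lam t = b
  generalize κ = k
  norm_num
  field_simp
  ring

end HolonomyReduction

end ProjTractor

end

/-! ### Bundles with a time function -/

section TimeFunction

open ProjTractor

variable {d m : ℕ} {P : Type*} [TopologicalSpace P] [ChartedSpace (Model d) P]
  {Q : Type*} [TopologicalSpace Q]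

variable (d) in
/-- A smooth flow `φ` on `P` with a smooth function `f` that increases at unit speed along the flow
lines, and its orbit space `Q`, where `s` picks the point of the orbit at which `f` vanishes. -/
structure TimeFunction (φ : ℝ → P → P) (f : P → ℝ) (pr : P → Q) (s : Q → P) : Prop where
  slice : IsSlice f pr s
  smooth_flow : ContMDiff (𝓘(ℝ, ℝ).prod 𝓘(ℝ, Model d)) 𝓘(ℝ, Model d) ∞
    (fun q : ℝ × P ↦ φ q.1 q.2)
  flow_zero : ∀ p, φ 0 p = p
  flow_add : ∀ t t' p, φ (t + t') p = φ t (φ t' p)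
  smooth_time : ContMDiff 𝓘(ℝ, Model d) 𝓘(ℝ, ℝ) ∞ f
  time_flow : ∀ t p, f (φ t p) = f p + t
  proj_flow : ∀ t p, pr (φ t p) = pr p
  section_proj : ∀ p, s (pr p) = φ (-f p) p

namespace TimeFunction

variable {φ : ℝ → P → P} {f : P → ℝ} {pr : P → Q} {s : Q → P}

theorem smooth_retraction (h : TimeFunction d φ f pr s) :
    ContMDiff 𝓘(ℝ, Model d) 𝓘(ℝ, Model d) ∞ (s ∘ pr) := by
  have h1 : s ∘ pr = fun p ↦ φ (-f p) p := funext h.section_proj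
  rw [h1]
  exact h.smooth_flow.comp (h.smooth_time.neg.prodMk contMDiff_id)

theorem smooth_flow_time (h : TimeFunction d φ f pr s) (t : ℝ) :
    ContMDiff 𝓘(ℝ, Model d) 𝓘(ℝ, Model d) ∞ (φ t) :=
  h.smooth_flow.comp (contMDiff_const.prodMk contMDiff_id)

theorem smooth_flow_line (h : TimeFunction d φ f pr s) (p : P) :
    ContMDiff 𝓘(ℝ, ℝ) 𝓘(ℝ, Model d) ∞ (fun t ↦ φ t p) :=
  h.smooth_flow.comp (contMDiff_id.prodMk contMDiff_const)

/-- The derivative of `f` is `1` on the generator of the flow. -/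
theorem mvfderiv_generator (h : TimeFunction d φ f pr s) (p : P) :
    mvfderiv 𝓘(ℝ, Model d) f (φ 0 p)
      (mfderiv 𝓘(ℝ, ℝ) 𝓘(ℝ, Model d) (fun t : ℝ ↦ φ t p) 0 (1 : ℝ)) = 1 := by
  have h1 : HasMFDerivAt 𝓘(ℝ, ℝ) 𝓘(ℝ, Model d) (fun t ↦ φ t p) 0
      ((1 : ℝ →L[ℝ] ℝ).smulRight
        (mfderiv 𝓘(ℝ, ℝ) 𝓘(ℝ, Model d) (fun t : ℝ ↦ φ t p) 0 (1 : ℝ))) := by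
    refine (((h.smooth_flow_line p).mdifferentiable (by simp)) 0).hasMFDerivAt.congr_mfderiv ?_
    exact ContinuousLinearMap.ext_ring (one_smul ℝ _).symm
  have h2 := hasDerivAt_comp_curve (γ := fun t ↦ φ t p)
    ((h.smooth_time.mdifferentiable (by simp)) (φ 0 p)) h1
  have h3 : f ∘ (fun t ↦ φ t p) = fun t ↦ f p + t := funext fun t ↦ h.time_flow t p
  rw [h3] at h2
  exact h2.unique ((hasDerivAt_id (0 : ℝ)).const_add (f p))

theorem mvfderiv_ne_zero (h : TimeFunction d φ f pr s) (p : P) :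
    ∃ v : TangentSpace 𝓘(ℝ, Model d) p, mvfderiv 𝓘(ℝ, Model d) f p v ≠ 0 := by
  have h1 := h.mvfderiv_generator (φ 0 p)
  rw [h.flow_zero, h.flow_zero] at h1
  exact ⟨_, h1.trans_ne one_ne_zero⟩

/-- The total space is the product of the time axis and the orbit space. -/
def timeDiffeomorph (h : TimeFunction d φ f pr s) [ChartedSpace (Model m) Q]
    (hs : ContMDiff 𝓘(ℝ, Model m) 𝓘(ℝ, Model d) ∞ s)
    (hpr : ContMDiff 𝓘(ℝ, Model d) 𝓘(ℝ, Model m) ∞ pr) :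
    Diffeomorph 𝓘(ℝ, Model d) (𝓘(ℝ, ℝ).prod 𝓘(ℝ, Model m)) P (ℝ × Q) ∞ where
  toFun p := (f p, pr p)
  invFun q := φ q.1 (s q.2)
  left_inv p := by
    change φ (f p) (s (pr p)) = p
    rw [h.section_proj, ← h.flow_add, add_neg_cancel, h.flow_zero]
  right_inv q := by
    change (f (φ q.1 (s q.2)), pr (φ q.1 (s q.2))) = q
    rw [h.time_flow, h.proj_flow, h.slice.apply_section, h.slice.proj_section, zero_add]
  contMDiff_toFun := h.smooth_time.prodMk hpr
  contMDiff_invFun := h.smooth_flow.comp (contMDiff_fst.prodMk (hs.comp contMDiff_snd))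

theorem isPrincipalRealBundle (h : TimeFunction d φ f pr s) [ChartedSpace (Model m) Q]
    (hs : ContMDiff 𝓘(ℝ, Model m) 𝓘(ℝ, Model d) ∞ s)
    (hpr : ContMDiff 𝓘(ℝ, Model d) 𝓘(ℝ, Model m) ∞ pr) :
    IsPrincipalRealBundle (d := d) (m := m) φ pr where
  act_smooth := h.smooth_flow
  act_zero := h.flow_zero
  act_add := h.flow_add
  proj_smooth := hpr
  local_triv b := by
    let Ψ : P ≃ₜ Q × ℝ :=
      (h.timeDiffeomorph hs hpr).toHomeomorph.trans (Homeomorph.prodComm ℝ Q)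
    refine ⟨univ, Ψ.toOpenPartialHomeomorph, isOpen_univ, trivial, rfl, univ_prod_univ.symm,
      ?_, ?_, fun _ _ ↦ rfl, fun p _ t ↦ ?_⟩
    · exact (hpr.prodMk h.smooth_time).contMDiffOn
    · exact (h.smooth_flow.comp (contMDiff_snd.prodMk (hs.comp contMDiff_fst))).contMDiffOn
    · exact Prod.ext (h.proj_flow t p) (h.time_flow t p)

variable [IsManifold 𝓘(ℝ, Model d) ∞ P]

/-- The differential of a smooth function is a smooth `1`-form. -/
theorem _root_.smoothOneForm_mvfderiv {f : P → ℝ} (hf : ContMDiff 𝓘(ℝ, Model d) 𝓘(ℝ, ℝ) ∞ f) :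
    SmoothOneForm (mvfderiv 𝓘(ℝ, Model d) f) := by
  intro x₀
  rw [contMDiffAt_hom_bundle]
  refine ⟨contMDiffAt_id, ?_⟩
  refine (ContMDiffAt.mfderiv_const (m := ∞) hf.contMDiffAt (by simp)).congr_of_eventuallyEq ?_
  filter_upwards [chart_source_mem_nhds (Model d) x₀] with x hx
  have hx' : x ∈ (trivializationAt (Model d) (TangentSpace 𝓘(ℝ, Model d)) x₀).baseSet := by
    simpa using hx
  unfold inTangentCoordinates
  rw [ContinuousLinearMap.inCoordinates_eq hx' (by simp),
    ContinuousLinearMap.inCoordinates_eq (x₀ := id x₀) (x := id x) hx'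
      (mem_univ _)]
  refine ContinuousLinearMap.ext fun v ↦ ?_
  refine Eq.symm ((congrFun (Trivialization.coe_continuousLinearEquivAt_eq _ (mem_univ _)) _).trans
    (DFunLike.congr_fun (TangentBundle.continuousLinearMapAt_model_space (f x₀) (f x)) _))

/-- The differential of the time function is a principal connection. -/
theorem isPrincipalConnection (h : TimeFunction d φ f pr s) :
    IsPrincipalConnection φ (mvfderiv 𝓘(ℝ, Model d) f) where
  smooth := smoothOneForm_mvfderiv h.smooth_time
  fundamental p := h.mvfderiv_generator p
  invariant t p v := by
    have hf := h.smooth_time.mdifferentiable (by simp)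
    have h1 := mvfderiv_comp_apply (I := 𝓘(ℝ, Model d)) p (hf (φ t p))
      (((h.smooth_flow_time t).mdifferentiable (by simp)) p) v
    rw [← h1]
    have h2 : f ∘ φ t = f + fun _ ↦ t := funext fun p ↦ h.time_flow t p
    rw [h2, mvfderiv_add (hf p) mdifferentiableAt_const, mvfderiv_const, add_zero]

end TimeFunction

end TimeFunction

/-! ### The flow of `N` on the open orbit and its orbit space -/

noncomputable section OrbitSpaceOfN

namespace ProjTractor

namespace HolonomyReduction

variable {n : ℕ} {M : Type*} [TopologicalSpace M] [ChartedSpace (Model (n + 1)) M]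
  [IsManifold 𝓘(ℝ, Model (n + 1)) ∞ M]
  {c : ProjectiveStructure n M} (D : HolonomyReduction c)

/-- The open orbit, as an open submanifold. -/
def openOrbitOpens : TopologicalSpace.Opens M := ⟨D.openOrbit, D.isOpen_openOrbit⟩

/-- Half of `l`, which increases at unit speed along the flow of `N`. -/
def time (x : D.openOrbitOpens) : ℝ := 1 / 2 * D.l x

theorem contMDiff_l : ContMDiff 𝓘(ℝ, Model (n + 1)) 𝓘(ℝ, ℝ) ∞
    (fun x : D.openOrbitOpens ↦ D.l x) :=
  fun x ↦ contMDiffAt_subtype_iff.mpr (D.contMDiffAt_l x.2)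

theorem contMDiff_time : ContMDiff 𝓘(ℝ, Model (n + 1)) 𝓘(ℝ, ℝ) ∞ D.time :=
  contMDiff_const.mul D.contMDiff_l

variable [T2Space M]

/-- Integral curves of `N` with a common point agree. -/
theorem integralCurve_unique {γ γ' : ℝ → M} {t : ℝ}
    (hγ : IsMIntegralCurve (I := 𝓘(ℝ, Model (n + 1))) γ D.N)
    (hγ' : IsMIntegralCurve (I := 𝓘(ℝ, Model (n + 1))) γ' D.N) (h : γ t = γ' t) : γ = γ' := by
  have : IsManifold 𝓘(ℝ, Model (n + 1)) 1 M := IsManifold.of_le (n := ∞) (by simp)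
  exact isMIntegralCurve_Ioo_eq_of_contMDiff_boundaryless (D.contMDiff_N.of_le (by simp)) hγ hγ' h

/-- As `N` vanishes outside the open orbit, the points there are stationary, so that an integral
curve which meets the open orbit stays in it. -/
theorem integralCurve_mem_openOrbit {γ : ℝ → M}
    (hγ : IsMIntegralCurve (I := 𝓘(ℝ, Model (n + 1))) γ D.N) {a : ℝ} (ha : γ a ∈ D.openOrbit)
    (b : ℝ) : γ b ∈ D.openOrbit := by
  by_contra hb
  have h := D.integralCurve_unique (t := b) hγ (isMIntegralCurve_const (D.N_eq_zero hb)) rfl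
  exact hb (congrFun h a ▸ ha)

theorem l_integralCurve {γ : ℝ → M} (hγ : IsMIntegralCurve (I := 𝓘(ℝ, Model (n + 1))) γ D.N)
    (h0 : γ 0 ∈ D.openOrbit) (t : ℝ) : D.l (γ t) = D.l (γ 0) + 2 * t := by
  have hderiv : ∀ s, HasDerivAt (fun s ↦ D.l (γ s) - 2 * s) 0 s := fun s ↦
    ((D.hasDerivAt_l (D.integralCurve_mem_openOrbit hγ h0 s) (hγ s)).sub
      ((hasDerivAt_id s).const_mul 2)).congr_deriv (by simp)
  have h := is_const_of_deriv_eq_zero (fun s ↦ (hderiv s).differentiableAt)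
    (fun s ↦ (hderiv s).deriv) t 0
  simp only [mul_zero, sub_zero] at h
  linarith

theorem exists_flow_openOrbit [CompactSpace M] :
    ∃ φ : ℝ → D.openOrbitOpens → D.openOrbitOpens, IsGlobalFlow D.N D.openOrbitOpens φ ∧
      (∀ s t x, φ (s + t) x = φ s (φ t x)) ∧
      ContMDiff (𝓘(ℝ, ℝ).prod 𝓘(ℝ, Model (n + 1))) 𝓘(ℝ, Model (n + 1)) ∞
        (fun p : ℝ × D.openOrbitOpens ↦ φ p.1 p.2) := by
  obtain ⟨φ, h0, hcurve, hadd, hsmooth⟩ := exists_smooth_flow D.contMDiff_N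
  have hmem : ∀ t (x : D.openOrbitOpens), φ t x ∈ D.openOrbit := fun t x ↦
    D.integralCurve_mem_openOrbit (a := 0) (hcurve x) ((h0 x).symm ▸ x.2) t
  refine ⟨fun t x ↦ ⟨φ t x, hmem t x⟩, fun x ↦ ⟨Subtype.ext (h0 x), hcurve x⟩,
    fun s t x ↦ Subtype.ext (hadd s t x), ?_⟩
  rw [← ContMDiff.subtypeVal_comp_iff]
  exact hsmooth.comp (contMDiff_fst.prodMk (contMDiff_subtype_val.comp contMDiff_snd))

variable {D} {φ : ℝ → D.openOrbitOpens → D.openOrbitOpens}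

theorem sameOrbit_iff (hφ : IsGlobalFlow D.N D.openOrbitOpens φ) (x y : D.openOrbitOpens) :
    SameOrbit D.N D.openOrbitOpens x y ↔ ∃ t, φ t x = y := by
  constructor
  · rintro ⟨γ, t, hγ, h0, ht⟩
    have h := D.integralCurve_unique (t := 0) hγ (hφ x).2 (by rw [h0, (hφ x).1])
    exact ⟨t, Subtype.ext ((congrFun h t).symm.trans ht)⟩
  · rintro ⟨t, rfl⟩
    exact ⟨fun t ↦ φ t x, t, (hφ x).2, congrArg Subtype.val (hφ x).1, rfl⟩

theorem proj_eq_iff (hφ : IsGlobalFlow D.N D.openOrbitOpens φ)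
    (hadd : ∀ s t x, φ (s + t) x = φ s (φ t x)) (x y : D.openOrbitOpens) :
    OrbitSpace.proj D.N D.openOrbitOpens x = OrbitSpace.proj D.N D.openOrbitOpens y ↔
      ∃ t, φ t x = y := by
  have hequiv : Equivalence (SameOrbit D.N D.openOrbitOpens) := by
    refine ⟨fun x ↦ ?_, fun {x y} ↦ ?_, fun {x y z} ↦ ?_⟩
    · exact (sameOrbit_iff hφ x x).mpr ⟨0, (hφ x).1⟩
    · rw [sameOrbit_iff hφ, sameOrbit_iff hφ]
      rintro ⟨t, rfl⟩
      exact ⟨-t, by rw [← hadd, neg_add_cancel, (hφ x).1]⟩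
    · rw [sameOrbit_iff hφ, sameOrbit_iff hφ, sameOrbit_iff hφ]
      rintro ⟨t, rfl⟩ ⟨s, rfl⟩
      exact ⟨s + t, hadd s t x⟩
  rw [← sameOrbit_iff hφ]
  exact Quot.eq.trans hequiv.eqvGen_iff

theorem time_flow (hφ : IsGlobalFlow D.N D.openOrbitOpens φ) (t : ℝ) (x : D.openOrbitOpens) :
    D.time (φ t x) = D.time x + t := by
  have h0 : (φ 0 x : M) = x := congrArg Subtype.val (hφ x).1
  have h := D.l_integralCurve (hφ x).2 (h0.symm ▸ x.2) t
  simp only [time]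
  rw [h, h0]
  ring

/-- The point of an orbit at which `l` vanishes. -/
def orbitSection (hφ : IsGlobalFlow D.N D.openOrbitOpens φ)
    (hadd : ∀ s t x, φ (s + t) x = φ s (φ t x)) :
    OrbitSpace D.N D.openOrbitOpens → D.openOrbitOpens :=
  Quot.lift (fun x ↦ φ (-D.time x) x) fun x y h ↦ by
    obtain ⟨t, rfl⟩ := (sameOrbit_iff hφ x y).mp h
    rw [time_flow hφ, ← hadd]
    congr 1
    ring

theorem timeFunction (hφ : IsGlobalFlow D.N D.openOrbitOpens φ)
    (hadd : ∀ s t x, φ (s + t) x = φ s (φ t x))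
    (hsmooth : ContMDiff (𝓘(ℝ, ℝ).prod 𝓘(ℝ, Model (n + 1))) 𝓘(ℝ, Model (n + 1)) ∞
      (fun p : ℝ × D.openOrbitOpens ↦ φ p.1 p.2)) :
    TimeFunction (n + 1) φ D.time (OrbitSpace.proj D.N D.openOrbitOpens)
      (orbitSection hφ hadd) where
  slice :=
    { continuous_proj := continuous_quot_mk
      continuous_section := continuous_quot_lift _
        (hsmooth.comp (D.contMDiff_time.neg.prodMk contMDiff_id)).continuous
      proj_section := Quot.ind fun x ↦ Eq.symm ((proj_eq_iff hφ hadd _ _).mpr ⟨_, rfl⟩)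
      apply_section := Quot.ind fun x ↦ by
        change D.time (φ (-D.time x) x) = 0
        rw [time_flow hφ, add_neg_cancel]
      section_proj := fun x hx ↦ by
        change φ (-D.time x) x = x
        rw [hx, neg_zero, (hφ x).1] }
  smooth_flow := hsmooth
  flow_zero x := (hφ x).1
  flow_add := hadd
  smooth_time := D.contMDiff_time
  time_flow := time_flow hφ
  proj_flow t x := Eq.symm ((proj_eq_iff hφ hadd _ _).mpr ⟨t, rfl⟩)
  section_proj _ := rfl

end HolonomyReduction

end ProjTractor

end OrbitSpaceOfN

theorem mainTheorem3 (n : ℕ) (hn : 1 ≤ n) {M : Type*} [TopologicalSpace M] [T2Space M]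
    [CompactSpace M] [ChartedSpace (ProjTractor.Model (n + 1)) M]
    [IsManifold 𝓘(ℝ, ProjTractor.Model (n + 1)) ∞ M]
    (c : ProjTractor.ProjectiveStructure n M) (D : ProjTractor.HolonomyReduction c) :
    ∃ hO : IsOpen D.openOrbit,
      let O : TopologicalSpace.Opens M := ⟨D.openOrbit, hO⟩
      let Q := ProjTractor.OrbitSpace D.N O
      let pr : O → Q := ProjTractor.OrbitSpace.proj D.N O
      let l : O → ℝ := fun x ↦ D.l x
      ∃ φ : ℝ → O → O, ProjTractor.IsGlobalFlow D.N O φ ∧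
        -- the fibres of `pr` are the orbits of the flow
        (∀ x y : O, pr x = pr y ↔ ∃ t, φ t x = y) ∧
        T2Space Q ∧ SecondCountableTopology Q ∧
        -- existence of the smooth structure
        ∃ cs : ChartedSpace (ProjTractor.Model n) Q,
          IsManifold 𝓘(ℝ, ProjTractor.Model n) ∞ Q ∧
          ProjTractor.IsPrincipalRealBundle (d := n + 1) (m := n) φ pr ∧
          -- uniqueness of the smooth structure
          (∀ cs' : ChartedSpace (ProjTractor.Model n) Q,
            @IsManifold ℝ _ _ _ _ _ _ 𝓘(ℝ, ProjTractor.Model n) ∞ Q _ cs' →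
            (∃ ψ : ℝ → O → O, @ProjTractor.IsPrincipalRealBundle (n + 1) n O _ _ Q _ cs' ψ pr) →
            @IsManifold.maximalAtlas ℝ _ _ _ _ _ _ 𝓘(ℝ, ProjTractor.Model n) ∞ Q _ cs' =
              @IsManifold.maximalAtlas ℝ _ _ _ _ _ _ 𝓘(ℝ, ProjTractor.Model n) ∞ Q _ cs) ∧
          -- the zero set of `l` is the image of a global section
          (∃ s : Q → O, ContMDiff 𝓘(ℝ, ProjTractor.Model n) 𝓘(ℝ, ProjTractor.Model (n + 1)) ∞ s ∧
            (∀ q, pr (s q) = q) ∧ range s = {x | l x = 0}) ∧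
          -- the global trivialisation, which is equivariant
          (∃ Ψ : Diffeomorph 𝓘(ℝ, ProjTractor.Model (n + 1))
              (𝓘(ℝ, ℝ).prod 𝓘(ℝ, ProjTractor.Model n)) O (ℝ × Q) ∞,
            (∀ x, Ψ x = (1 / 2 * l x, pr x)) ∧
            ∀ t x, Ψ (φ t x) = (1 / 2 * l x + t, pr x)) ∧
          -- the principal connection
          ProjTractor.IsPrincipalConnection φ
            (fun x ↦ (1 / 2 : ℝ) • mvfderiv 𝓘(ℝ, ProjTractor.Model (n + 1)) l x) := by
  refine ⟨D.isOpen_openOrbit, ?_⟩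
  intro O Q pr l
  obtain ⟨φ, hφ, hadd, hsmooth⟩ := D.exists_flow_openOrbit
  have h : TimeFunction (n + 1) φ D.time pr (D.orbitSection hφ hadd) :=
    D.timeFunction hφ hadd hsmooth
  have htime : ∀ x : O, D.time x = 1 / 2 * l x := fun _ ↦ rfl
  have hT2 : T2Space Q := IsSlice.t2Space (P := D.openOrbitOpens) h.slice
  have : SecondCountableTopology M :=
    ChartedSpace.secondCountable_of_sigmaCompact (ProjTractor.Model (n + 1)) M
  have hsc : SecondCountableTopology Q :=
    IsSlice.secondCountableTopology (P := D.openOrbitOpens) h.slice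
  obtain ⟨cs, hm, hs, hpr⟩ := exists_slice_manifold (E := ProjTractor.Model (n + 1))
    (F := ProjTractor.Model n) (by simp) h.slice h.smooth_time h.mvfderiv_ne_zero
    h.smooth_retraction
  have hbundle := h.isPrincipalRealBundle hs hpr
  refine ⟨φ, hφ, D.proj_eq_iff hφ hadd, hT2, hsc, cs, hm, hbundle, ?_, ?_, ?_, ?_⟩
  · rintro cs' hm' ⟨ψ, hψ⟩
    exact maximalAtlas_eq_of_isPrincipalRealBundle hm hm' hbundle hψ
  · refine ⟨D.orbitSection hφ hadd, hs, h.slice.proj_section, Set.ext fun x ↦ ?_⟩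
    have hl : D.time x = 0 ↔ l x = 0 := by simp [htime]
    rw [mem_ofPred_eq, ← hl]
    refine ⟨?_, fun hx ↦ ⟨pr x, h.slice.section_proj x hx⟩⟩
    rintro ⟨q, rfl⟩
    exact h.slice.apply_section q
  · refine ⟨h.timeDiffeomorph hs hpr, fun x ↦ rfl, fun t x ↦ ?_⟩
    exact Prod.ext (h.time_flow t x) (h.proj_flow t x)
  · have hω : (fun x ↦ (1 / 2 : ℝ) • mvfderiv 𝓘(ℝ, ProjTractor.Model (n + 1)) l x) =
        mvfderiv 𝓘(ℝ, ProjTractor.Model (n + 1)) D.time := by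
      funext x
      have hd := mvfderiv_mul (mdifferentiableAt_const (I := 𝓘(ℝ, ProjTractor.Model (n + 1)))
        (c := (1 / 2 : ℝ)) (x := x)) (D.contMDiff_l.mdifferentiable (by simp) x)
      rw [mvfderiv_const, smul_zero, add_zero] at hd
      exact hd.symm
    rw [hω]
    exact h.isPrincipalConnection
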